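/- Let $p\in\mathbb N$, let $n=n_1+\dots+n_p$, $k=k_1+\dots+k_p$, $m=m_1+\dots+m_p$, and let $\gamma>0$. Consider the real generalized plant $$\dot x=Ax+B_0d+Bu,\qquad e=C_0x+D_0d+Eu,\qquad y=Cx+Fd,$$ where $A\in\mathbb R^{n\times n}$, $B\in\mathbb R^{n\times m}$, $C\in\mathbb R^{k\times n}$ are lower block-triangular ($p\times p$ blocks) for the given partitions of $n,m,k$. A \emph{structured controller} is a system $u=D^Ky+C^K\xi$, $\dot\xi=A^K\xi+B^Ky$, together with a partition $n^K=n^K_1+\dots+n^K_p$ of its state dimension, such that $A^K,B^K,C^K,D^K$ are all lower block-triangular. The closed loop is $$\begin{pmatrix}\mathcal A&\mathcal B\\\mathcal C&\mathcal D\end{pmatrix}=\begin{pmatrix}A&0&B_0\\0&0&0\\C_0&0&D_0\end{pmatrix}+\begin{pmatrix}B&0\\0&I\\E&0\end{pmatrix}\begin{pmatrix}D^K&C^K\\B^K&A^K\end{pmatrix}\begin{pmatrix}C&0&F\\0&I&0\end{pmatrix},$$ and the bounded-real LMI for a symmetric $\mathcal X$ is $$\mathcal X\succ0,\qquad\begin{pmatrix}\mathcal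 A^T\mathcal X+\mathcal X\mathcal A&\mathcal X\mathcal B&\mathcal C^T\\\mathcal B^T\mathcal X&-\gamma I&\mathcal D^T\\\mathcal C&\mathcal D&-\gamma I\end{pmatrix}\prec0.\tag{lmi1}$$ A controller solves the $H_\infty$-synthesis problem if $\mathcal A$ is Hurwitz and $\|\mathcal C(sI-\mathcal A)^{-1}\mathcal B+\mathcal D\|_\infty<\gamma$. For any partition into $p$ blocks let $R_j$ be the $j$-th block column of the identity matrix, $L_j$ the block columns $j,\dots,p$ and $\Lambda_j$ the block columns $1,\dots,j-1$. For $j=1,\dots,p+1$ let $\Gamma_j$ be any basis matrix (full column rank, with range equal to the subspace) of $$\ker\begin{pmatrix}\Lambda_j^TC&\Lambda_j^TF&0\\L_j^TB^T&0&L_j^TE^T\end{pmatrix}.$$ With variables $\hat X_j=\hat X_j^T$, $\hat Y_j=\hat Y_j^T$, $\hat Z_j$ of dimensions $n_1+\dots+n_{j-1}$, $n_j+\dots+n_p$ and $(n_j+\dots+n_p)\times(n_1+\dots+n_{j-1})$ put $$X_j=\begin{pmatrix}\hat X_j&\hat Z_j^T\\0&I\end{pmatrix},\qquad Y_j=\begin{pmatrix}I&0\\-\hat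 Z_j&\hat Y_j\end{pmatrix},\qquad j=1,\dots,p+1,$$ so that $X_1=I$ and $Y_{p+1}=I$. Consider the LMIs $$\Gamma_j^T\begin{pmatrix}(X_j^TAY_j)^T+X_j^TAY_j&X_j^TB_0&Y_j^TC_0^T\\B_0^TX_j&-\gamma I&D_0^T\\C_0Y_j&D_0&-\gamma I\end{pmatrix}\Gamma_j\prec0,\quad j=1,\dots,p+1,\tag{st1}$$ $$\begin{pmatrix}Y_j^TX_j&X_j^TY_{j+1}\\Y_{j+1}^TX_j&Y_{j+1}^TX_{j+1}\end{pmatrix}\succ0,\quad j=1,\dots,p.\tag{st2}$$ (a) There is a structured controller for which (lmi1) holds with some symmetric $\mathcal X$ if and only if (st1)–(st2) are feasible. (b) If (st1)–(st2) are feasible, there is a structured controller of McMillan degree at most $np$ that solves the $H_\infty$-synthesis problem. (c) Such a controller is obtained from any solution of (st1)–(st2) as follows. Put $X=(X_2\ \cdots\ X_{p+1})$, $Y=(Y_1\ \cdots\ Y_p)$, $U=I_{np}$, and let $V=(V_1\ \cdots\ V_p)\in\mathbb R^{np\times np}$ be the matrix whose block $(i,j)$ is $Y_{i+1}^TX_j-X_{i+1}^TY_j$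 for $i\ge j$ and $0$ for $i<j$; partition $np=n+\dots+n$. For $\nu=1,\dots,p$ let $K_\nu$ be any basis matrix of $$\ker\begin{pmatrix}\Lambda_\nu^TCY&\Lambda_\nu^TC&\Lambda_\nu^TF&0\\\Lambda_\nu^TV&0&0&0\end{pmatrix},$$ and with $\mathrm{He}(M)=M^T+M$ consider, in unstructured matrices $S_1,\dots,S_p$ of compatible dimensions, the inequalities $$\mathrm{He}\Big[K_\nu^T\Big(\begin{pmatrix}AY&A&B_0&0\\X^TAY&X^TA&X^TB_0&0\\0&0&-\frac\gamma2I&0\\C_0Y&C_0&D_0&-\frac\gamma2I\end{pmatrix}+\sum_{j=\nu}^p\begin{pmatrix}BL_j&0\\X^TBL_j&U^TL_j\\0&0\\EL_j&0\end{pmatrix}S_j\begin{pmatrix}R_j^TCY&R_j^TC&R_j^TF&0\\R_j^TV&0&0&0\end{pmatrix}\Big)K_\nu\Big]\prec0.\tag{coco}$$ They can be solved recursively for $\nu=p,p-1,\dots,1$: whatever $S_p,\dots,S_{\nu+1}$ have been chosen so as to satisfy (coco) for the indices $p,\dots,\nu+1$, there is an $S_\nu$ that satisfies (coco) for the index $\nu$.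 For arbitrary $S_1,\dots,S_p$ satisfying all the inequalities (coco), the matrices given by $$\begin{pmatrix}D^K&C^K\\B^K&A^K\end{pmatrix}=\sum_{j=1}^p\begin{pmatrix}L_j&0\\0&L_j\end{pmatrix}S_j\begin{pmatrix}R_j^T&0\\0&R_j^T\end{pmatrix}$$ (with $A^K$ partitioned according to $np=n+\dots+n$) define a structured controller of McMillan degree at most $np$ that satisfies (lmi1) for some symmetric $\mathcal X$ and solves the $H_\infty$-synthesis problem. -/

import Mathlib

open scoped Matrix

noncomputable section

namespace NestedHinf

/-! ### Block partitions

A vector partitioned into `p` blocks is indexed by `Σ i : Fin p, κ i`. Blocks are numbered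
`0, …, p - 1`; the objects with `p + 1` indices are numbered `0, …, p`. -/

/-- Indices of vectors partitioned into `p` blocks, the `i`-th one indexed by `κ i`. -/
abbrev Blk {p : ℕ} (κ : Fin p → Type) : Type := Σ i : Fin p, κ i

/-- Indices of vectors partitioned into `p` blocks of dimensions `n 0, …, n (p - 1)`. -/
abbrev Idx {p : ℕ} (n : Fin p → ℕ) : Type := Blk fun i => Fin (n i)

/-- The indices in the blocks strictly before the `j`-th one. -/
abbrev Lo {p : ℕ} (κ : Fin p → Type) (j : Fin (p + 1)) : Type :=
  {a : Blk κ // a.1.val < j.val}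

/-- The indices in the blocks from the `j`-th one on. -/
abbrev Hi {p : ℕ} (κ : Fin p → Type) (j : Fin (p + 1)) : Type :=
  {a : Blk κ // ¬ a.1.val < j.val}

/-- All blocks strictly above the block diagonal vanish. -/
def LowerTri {p : ℕ} {κ κ' : Fin p → Type} (M : Matrix (Blk κ) (Blk κ') ℝ) : Prop :=
  ∀ a b, a.1 < b.1 → M a b = 0

/-- The block columns `j, …, p - 1` of the identity matrix (the matrix `L_j`). -/
def selL {p : ℕ} (κ : Fin p → Type) [∀ i, DecidableEq (κ i)] (j : Fin (p + 1)) :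
    Matrix (Blk κ) (Hi κ j) ℝ :=
  (1 : Matrix (Blk κ) (Blk κ) ℝ).submatrix id Subtype.val

/-- The block columns `0, …, j - 1` of the identity matrix (the complement of `L_j`). -/
def selLc {p : ℕ} (κ : Fin p → Type) [∀ i, DecidableEq (κ i)] (j : Fin (p + 1)) :
    Matrix (Blk κ) (Lo κ j) ℝ :=
  (1 : Matrix (Blk κ) (Blk κ) ℝ).submatrix id Subtype.val

/-- The `j`-th block column of the identity matrix (the matrix `R_j`). -/
def selR {p : ℕ} (κ : Fin p → Type) [∀ i, DecidableEq (κ i)] (j : Fin p) :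
    Matrix (Blk κ) (κ j) ℝ :=
  (1 : Matrix (Blk κ) (Blk κ) ℝ).submatrix id (Sigma.mk j)

/-! ### Matrix notions -/

/-- A block matrix with three block rows and three block columns. -/
def block3 {a b c a' b' c' : Type}
    (M11 : Matrix a a' ℝ) (M12 : Matrix a b' ℝ) (M13 : Matrix a c' ℝ)
    (M21 : Matrix b a' ℝ) (M22 : Matrix b b' ℝ) (M23 : Matrix b c' ℝ)
    (M31 : Matrix c a' ℝ) (M32 : Matrix c b' ℝ) (M33 : Matrix c c' ℝ) :
    Matrix (a ⊕ (b ⊕ c)) (a' ⊕ (b' ⊕ c')) ℝ :=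
  Matrix.fromBlocks M11 (Matrix.fromCols M12 M13) (Matrix.fromRows M21 M31)
    (Matrix.fromBlocks M22 M23 M32 M33)

/-- `He(M) = Mᵀ + M`. -/
def He {a : Type} (M : Matrix a a ℝ) : Matrix a a ℝ := Mᵀ + M

/-- Symmetric and negative definite. -/
def NegDef {a : Type} (M : Matrix a a ℝ) : Prop := (-M).PosDef

/-- The kernel of a matrix. -/
def ker {a b : Type} [Fintype b] (M : Matrix a b ℝ) : Submodule ℝ (b → ℝ) :=
  LinearMap.ker M.mulVecLin

/-- `M` has full column rank and its range is `S`. -/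
def IsBasisMatrix {a b : Type} [Fintype b] (M : Matrix a b ℝ) (S : Submodule ℝ (a → ℝ)) : Prop :=
  LinearIndependent ℝ M.col ∧ LinearMap.range M.mulVecLin = S

/-! ### State-space systems -/

/-- The transfer matrix `C (sI - A)⁻¹ B + D` as a matrix of rational functions in `s`. -/
def transferFun {x i o : Type} [Fintype x] [DecidableEq x]
    (A : Matrix x x ℝ) (B : Matrix x i ℝ) (C : Matrix o x ℝ) (D : Matrix o i ℝ) :
    Matrix o i (RatFunc ℝ) :=
  C.map (algebraMap ℝ (RatFunc ℝ)) *
      (Matrix.scalar x RatFunc.X - A.map (algebraMap ℝ (RatFunc ℝ)))⁻¹ *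
      B.map (algebraMap ℝ (RatFunc ℝ)) +
    D.map (algebraMap ℝ (RatFunc ℝ))

/-- The McMillan degree of the transfer matrix realized by `(A, B, C, D)`: the least state
dimension among all its realizations. -/
def mcMillanDegree {x i o : Type} [Fintype x] [DecidableEq x]
    (A : Matrix x x ℝ) (B : Matrix x i ℝ) (C : Matrix o x ℝ) (D : Matrix o i ℝ) : ℕ :=
  sInf {r : ℕ | ∃ (A' : Matrix (Fin r) (Fin r) ℝ) (B' : Matrix (Fin r) i ℝ)
    (C' : Matrix o (Fin r) ℝ) (D' : Matrix o i ℝ),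
    transferFun A' B' C' D' = transferFun A B C D}

/-- All complex eigenvalues lie in the open left half-plane. -/
def Hurwitz {x : Type} [Fintype x] [DecidableEq x] (A : Matrix x x ℝ) : Prop :=
  ∀ μ ∈ spectrum ℂ (A.map (algebraMap ℝ ℂ)), μ.re < 0

/-- The value of the transfer matrix `C (sI - A)⁻¹ B + D` at `s ∈ ℂ`. -/
def transferAt {x i o : Type} [Fintype x] [DecidableEq x]
    (A : Matrix x x ℝ) (B : Matrix x i ℝ) (C : Matrix o x ℝ) (D : Matrix o i ℝ) (s : ℂ) :
    Matrix o i ℂ :=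
  C.map (algebraMap ℝ ℂ) * (Matrix.scalar x s - A.map (algebraMap ℝ ℂ))⁻¹ *
      B.map (algebraMap ℝ ℂ) +
    D.map (algebraMap ℝ ℂ)

/-- The largest singular value, i.e. the operator norm for the Euclidean norms. -/
def specNorm {i o : Type} [Fintype i] [DecidableEq i] [Fintype o] (M : Matrix o i ℂ) : ℝ :=
  ‖LinearMap.toContinuousLinearMap (Matrix.toEuclideanLin M)‖

/-- The `H∞`-norm of a stable transfer matrix: the supremum of its largest singular value over the
open right half-plane. -/
def hinfNorm {x i o : Type} [Fintype x] [DecidableEq x] [Fintype i] [DecidableEq i] [Fintype o]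
    (A : Matrix x x ℝ) (B : Matrix x i ℝ) (C : Matrix o x ℝ) (D : Matrix o i ℝ) : ENNReal :=
  ⨆ (s : ℂ) (_ : 0 < s.re), ENNReal.ofReal (specNorm (transferAt A B C D s))

/-- A generalized plant `ẋ = A x + B₀ d + B u`, `e = C₀ x + D₀ d + E u`, `y = C x + F d`, where
`x`, `y`, `u` are partitioned into `p` blocks of dimensions `n i`, `k i`, `m i`, and `d`, `e` have
dimensions `nd`, `ne`. -/
structure Plant {p : ℕ} (n k m : Fin p → ℕ) (nd ne : ℕ) where
  A : Matrix (Idx n) (Idx n) ℝ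
  B₀ : Matrix (Idx n) (Fin nd) ℝ
  B : Matrix (Idx n) (Idx m) ℝ
  C₀ : Matrix (Fin ne) (Idx n) ℝ
  D₀ : Matrix (Fin ne) (Fin nd) ℝ
  E : Matrix (Fin ne) (Idx m) ℝ
  C : Matrix (Idx k) (Idx n) ℝ
  F : Matrix (Idx k) (Fin nd) ℝ

/-- `A`, `B`, `C` are lower block-triangular. -/
def Plant.IsStructured {p : ℕ} {n k m : Fin p → ℕ} {nd ne : ℕ} (P : Plant n k m nd ne) : Prop :=
  LowerTri P.A ∧ LowerTri P.B ∧ LowerTri P.C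

/-- A controller `ξ̇ = A ξ + B y`, `u = C ξ + D y` whose state is partitioned into `p` blocks, the
`i`-th one indexed by `κ i`. -/
structure Controller {p : ℕ} (κ : Fin p → Type) (k m : Fin p → ℕ) where
  A : Matrix (Blk κ) (Blk κ) ℝ
  B : Matrix (Blk κ) (Idx k) ℝ
  C : Matrix (Idx m) (Blk κ) ℝ
  D : Matrix (Idx m) (Idx k) ℝ

namespace Controller

variable {p : ℕ} {κ : Fin p → Type} {k m : Fin p → ℕ}

/-- All four controller matrices are lower block-triangular. -/
def IsStructured (K : Controller κ k m) : Prop :=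
  LowerTri K.A ∧ LowerTri K.B ∧ LowerTri K.C ∧ LowerTri K.D

/-- The McMillan degree of the transfer matrix of the controller. -/
def degree [∀ i, Fintype (κ i)] [∀ i, DecidableEq (κ i)] (K : Controller κ k m) : ℕ :=
  mcMillanDegree K.A K.B K.C K.D

/-- The matrix `[D C; B A]`. -/
def mat (K : Controller κ k m) : Matrix (Idx m ⊕ Blk κ) (Idx k ⊕ Blk κ) ℝ :=
  Matrix.fromBlocks K.D K.C K.B K.A

/-- The controller with a given matrix `[D C; B A]`. -/
def ofMat (M : Matrix (Idx m ⊕ Blk κ) (Idx k ⊕ Blk κ) ℝ) : Controller κ k m where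
  D := M.toBlocks₁₁
  C := M.toBlocks₁₂
  B := M.toBlocks₂₁
  A := M.toBlocks₂₂

end Controller

/-! ### The closed loop -/

section ClosedLoop

variable {p : ℕ} {n k m : Fin p → ℕ} {nd ne : ℕ} {κ : Fin p → Type}
  [∀ i, Fintype (κ i)] [∀ i, DecidableEq (κ i)]

/-- The matrix `[B 0; 0 I]`. -/
def extB (P : Plant n k m nd ne) (κ : Fin p → Type) [∀ i, DecidableEq (κ i)] :
    Matrix (Idx n ⊕ Blk κ) (Idx m ⊕ Blk κ) ℝ :=
  Matrix.fromBlocks P.B 0 0 1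

/-- The matrix `[C 0; 0 I]`. -/
def extC (P : Plant n k m nd ne) (κ : Fin p → Type) [∀ i, DecidableEq (κ i)] :
    Matrix (Idx k ⊕ Blk κ) (Idx n ⊕ Blk κ) ℝ :=
  Matrix.fromBlocks P.C 0 0 1

/-- The matrix `[E 0]`. -/
def extE (P : Plant n k m nd ne) (κ : Fin p → Type) : Matrix (Fin ne) (Idx m ⊕ Blk κ) ℝ :=
  Matrix.fromCols P.E 0

/-- The matrix `[F; 0]`. -/
def extF (P : Plant n k m nd ne) (κ : Fin p → Type) : Matrix (Idx k ⊕ Blk κ) (Fin nd) ℝ :=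
  Matrix.fromRows P.F 0

/-- The state matrix of the closed loop. -/
def clA (P : Plant n k m nd ne) (K : Controller κ k m) :
    Matrix (Idx n ⊕ Blk κ) (Idx n ⊕ Blk κ) ℝ :=
  Matrix.fromBlocks P.A 0 0 0 + extB P κ * K.mat * extC P κ

/-- The input matrix of the closed loop. -/
def clB (P : Plant n k m nd ne) (K : Controller κ k m) : Matrix (Idx n ⊕ Blk κ) (Fin nd) ℝ :=
  Matrix.fromRows P.B₀ 0 + extB P κ * K.mat * extF P κ

/-- The output matrix of the closed loop. -/
def clC (P : Plant n k m nd ne) (K : Controller κ k m) : Matrix (Fin ne) (Idx n ⊕ Blk κ) ℝ :=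
  Matrix.fromCols P.C₀ 0 + extE P κ * K.mat * extC P κ

/-- The feedthrough matrix of the closed loop. -/
def clD (P : Plant n k m nd ne) (K : Controller κ k m) : Matrix (Fin ne) (Fin nd) ℝ :=
  P.D₀ + extE P κ * K.mat * extF P κ

/-- The bounded-real LMI of the closed loop, with certificate `𝒳`. -/
def BoundedRealLMI (P : Plant n k m nd ne) (K : Controller κ k m) (γ : ℝ)
    (𝒳 : Matrix (Idx n ⊕ Blk κ) (Idx n ⊕ Blk κ) ℝ) : Prop :=
  𝒳.PosDef ∧
    NegDef (block3
      ((clA P K)ᵀ * 𝒳 + 𝒳 * clA P K) (𝒳 * clB P K)  (clC P K)ᵀ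
      ((clB P K)ᵀ * 𝒳)               (-(γ • 1))     (clD P K)ᵀ
      (clC P K)                      (clD P K)      (-(γ • 1)))

/-- The controller solves the `H∞`-synthesis problem: the closed loop is internally stable and
the `H∞`-norm of `d → e` is smaller than `γ`. -/
def SolvesHinf (P : Plant n k m nd ne) (K : Controller κ k m) (γ : ℝ) : Prop :=
  Hurwitz (clA P K) ∧
    hinfNorm (clA P K) (clB P K) (clC P K) (clD P K) < ENNReal.ofReal γ

end ClosedLoop

/-! ### The synthesis LMIs -/

/-- The decision variables. -/
structure DecVars {p : ℕ} (n : Fin p → ℕ) where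
  Xh : ∀ j : Fin (p + 1), Matrix (Lo (fun i => Fin (n i)) j) (Lo (fun i => Fin (n i)) j) ℝ
  Yh : ∀ j : Fin (p + 1), Matrix (Hi (fun i => Fin (n i)) j) (Hi (fun i => Fin (n i)) j) ℝ
  Zh : ∀ j : Fin (p + 1), Matrix (Hi (fun i => Fin (n i)) j) (Lo (fun i => Fin (n i)) j) ℝ

namespace DecVars

variable {p : ℕ} {n : Fin p → ℕ}

/-- The matrix `X_j = [X̂_j Ẑ_jᵀ; 0 I]`. -/
def X (W : DecVars n) (j : Fin (p + 1)) : Matrix (Idx n) (Idx n) ℝ :=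
  Matrix.reindex (Equiv.sumCompl fun a : Idx n => a.1.val < j.val)
    (Equiv.sumCompl fun a : Idx n => a.1.val < j.val)
    (Matrix.fromBlocks (W.Xh j) (W.Zh j)ᵀ 0 1)

/-- The matrix `Y_j = [I 0; -Ẑ_j Ŷ_j]`. -/
def Y (W : DecVars n) (j : Fin (p + 1)) : Matrix (Idx n) (Idx n) ℝ :=
  Matrix.reindex (Equiv.sumCompl fun a : Idx n => a.1.val < j.val)
    (Equiv.sumCompl fun a : Idx n => a.1.val < j.val)
    (Matrix.fromBlocks 1 0 (-(W.Zh j)) (W.Yh j))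

end DecVars

section Synthesis

variable {p : ℕ} {n k m : Fin p → ℕ} {nd ne : ℕ}

/-- The subspace of which `Γ_j` has to be a basis matrix. -/
def gammaSpace (P : Plant n k m nd ne) (j : Fin (p + 1)) :
    Submodule ℝ (Idx n ⊕ (Fin nd ⊕ Fin ne) → ℝ) :=
  ker (Matrix.fromBlocks
    ((selLc (fun i => Fin (k i)) j)ᵀ * P.C)
    (Matrix.fromCols ((selLc (fun i => Fin (k i)) j)ᵀ * P.F) 0)
    ((selL (fun i => Fin (m i)) j)ᵀ * P.Bᵀ)
    (Matrix.fromCols 0 ((selL (fun i => Fin (m i)) j)ᵀ * P.Eᵀ)))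

/-- The decision variables `W` satisfy the LMIs: the `p + 1` projected ones and the `p` coupling
ones. -/
def Feasible (P : Plant n k m nd ne) (γ : ℝ) {g : Fin (p + 1) → ℕ}
    (Γ : ∀ j, Matrix (Idx n ⊕ (Fin nd ⊕ Fin ne)) (Fin (g j)) ℝ) (W : DecVars n) : Prop :=
  (∀ j, (W.Xh j).IsSymm ∧ (W.Yh j).IsSymm) ∧
  (∀ j : Fin (p + 1), NegDef ((Γ j)ᵀ * block3
      (((W.X j)ᵀ * P.A * W.Y j)ᵀ + (W.X j)ᵀ * P.A * W.Y j) ((W.X j)ᵀ * P.B₀) ((W.Y j)ᵀ * P.C₀ᵀ)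
      (P.B₀ᵀ * W.X j)                                      (-(γ • 1))        P.D₀ᵀ
      (P.C₀ * W.Y j)                                       P.D₀              (-(γ • 1)) * Γ j)) ∧
  (∀ j : Fin p, (Matrix.fromBlocks
      ((W.Y j.castSucc)ᵀ * W.X j.castSucc) ((W.X j.castSucc)ᵀ * W.Y j.succ)
      ((W.Y j.succ)ᵀ * W.X j.castSucc)     ((W.Y j.succ)ᵀ * W.X j.succ)).PosDef)

/-! ### The controller construction -/

/-- The partition of the state of the constructed controller: `p` blocks of dimension
`n 0 + ⋯ + n (p - 1)` each. -/
abbrev KBlk (n : Fin p → ℕ) : Fin p → Type := fun _ => Idx n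

/-- Indices for `p + 1` consecutive blocks of dimension `n 0 + ⋯ + n (p - 1)` each. -/
abbrev Ext (n : Fin p → ℕ) : Type := Fin (p + 1) × Idx n

/-- `(X_0 X_1 ⋯ X_p)`, where `X_0 = I`. -/
def rowX (W : DecVars n) : Matrix (Idx n) (Ext n) ℝ := Matrix.of fun a b => W.X b.1 a b.2

/-- `(Y_0 ⋯ Y_{p-1} Y_p)`, where `Y_p = I`. -/
def rowY (W : DecVars n) : Matrix (Idx n) (Ext n) ℝ := Matrix.of fun a b => W.Y b.1 a b.2

/-- `(0 I)`, i.e. `(U_0 U_1 ⋯ U_p)` with `U_0 = 0` and `(U_1 ⋯ U_p) = I`. -/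
def rowU (n : Fin p → ℕ) : Matrix (Blk (KBlk n)) (Ext n) ℝ :=
  Matrix.of fun a b => if b.1 = a.1.succ ∧ b.2 = a.2 then 1 else 0

/-- `(V_0 ⋯ V_{p-1} 0)`, where the `i`-th block of `V_j` is `Y_{i+1}ᵀ X_j - X_{i+1}ᵀ Y_j` for
`j ≤ i` and `0` otherwise. -/
def rowV (W : DecVars n) : Matrix (Blk (KBlk n)) (Ext n) ℝ :=
  Matrix.of fun a b => if b.1 ≤ a.1.castSucc then
    ((W.Y a.1.succ)ᵀ * W.X b.1 - (W.X a.1.succ)ᵀ * W.Y b.1) a.2 b.2 else 0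

/-- The subspace of which `K_ν` has to be a basis matrix. -/
def kappaSpace (P : Plant n k m nd ne) (W : DecVars n) (ν : Fin p) :
    Submodule ℝ (Ext n ⊕ (Fin nd ⊕ Fin ne) → ℝ) :=
  ker (Matrix.fromBlocks
    ((selLc (fun i => Fin (k i)) ν.castSucc)ᵀ * P.C * rowY W)
    (Matrix.fromCols ((selLc (fun i => Fin (k i)) ν.castSucc)ᵀ * P.F) 0)
    ((selLc (KBlk n) ν.castSucc)ᵀ * rowV W)
    0)

/-- The unstructured parameters `S_0, …, S_{p-1}` of a structured controller. -/
abbrev Params (n k m : Fin p → ℕ) : Type :=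
  ∀ j : Fin p, Matrix (Hi (fun i => Fin (m i)) j.castSucc ⊕ Hi (KBlk n) j.castSucc)
    (Fin (k j) ⊕ Idx n) ℝ

/-- The controller with matrix `[D C; B A] = ∑ j, diag(L_j, L_j) S_j diag(R_jᵀ, R_jᵀ)`. -/
def Params.controller (S : Params n k m) : Controller (KBlk n) k m :=
  Controller.ofMat (∑ j : Fin p,
    Matrix.fromBlocks (selL (fun i => Fin (m i)) j.castSucc) 0 0 (selL (KBlk n) j.castSucc) *
      S j *
      Matrix.fromBlocks (selR (fun i => Fin (k i)) j)ᵀ 0 0 (selR (KBlk n) j)ᵀ)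

/-- The constant term of the inequalities of the controller construction. -/
def stepQ (P : Plant n k m nd ne) (γ : ℝ) (W : DecVars n) :
    Matrix (Ext n ⊕ (Fin nd ⊕ Fin ne)) (Ext n ⊕ (Fin nd ⊕ Fin ne)) ℝ :=
  block3
    ((rowX W)ᵀ * P.A * rowY W) ((rowX W)ᵀ * P.B₀)  0
    0                          (-((γ / 2) • 1))    0
    (P.C₀ * rowY W)            P.D₀                (-((γ / 2) • 1))

/-- The left factor of `S_j` in the inequalities of the controller construction. -/
def stepM (P : Plant n k m nd ne) (W : DecVars n) (j : Fin p) :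
    Matrix (Ext n ⊕ (Fin nd ⊕ Fin ne))
      (Hi (fun i => Fin (m i)) j.castSucc ⊕ Hi (KBlk n) j.castSucc) ℝ :=
  Matrix.fromBlocks
    ((rowX W)ᵀ * P.B * selL (fun i => Fin (m i)) j.castSucc)
    ((rowU n)ᵀ * selL (KBlk n) j.castSucc)
    (Matrix.fromRows 0 (P.E * selL (fun i => Fin (m i)) j.castSucc))
    0

/-- The right factor of `S_j` in the inequalities of the controller construction. -/
def stepN (P : Plant n k m nd ne) (W : DecVars n) (j : Fin p) :
    Matrix (Fin (k j) ⊕ Idx n) (Ext n ⊕ (Fin nd ⊕ Fin ne)) ℝ :=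
  Matrix.fromBlocks
    ((selR (fun i => Fin (k i)) j)ᵀ * P.C * rowY W)
    (Matrix.fromCols ((selR (fun i => Fin (k i)) j)ᵀ * P.F) 0)
    ((selR (KBlk n) j)ᵀ * rowV W)
    0

/-- The `ν`-th inequality of the controller construction. It involves `S_j` for `j ≥ ν` only. -/
def StepLMI (P : Plant n k m nd ne) (γ : ℝ) (W : DecVars n) {h : Fin p → ℕ}
    (Kb : ∀ ν, Matrix (Ext n ⊕ (Fin nd ⊕ Fin ne)) (Fin (h ν)) ℝ) (S : Params n k m)
    (ν : Fin p) : Prop :=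
  NegDef (He ((Kb ν)ᵀ * stepQ P γ W * Kb ν +
    ∑ j ∈ Finset.Ici ν, (Kb ν)ᵀ * (stepM P W j * S j * stepN P W j) * Kb ν))

end Synthesis

end NestedHinf

end

/-!
The bounded-real inequality is a dissipation inequality, a quadratic form in the closed-loop state
`z`, the costate `𝒳 z` and the exogenous signals.

Given a structured controller, eliminate the controller states of blocks `j, …, p`: the Schur
complements `Q_j` of `𝒳` are positive definite and increase with `j`. If the measured outputs of
the blocks before `j` and the dual inputs of the blocks from `j` on vanish, so does the controller
term, by block triangularity, and the form of the plant is negative for the costate `Q_j x`. The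
matrices `Q_j + ε j I` increase strictly, and factoring them as `X_j Y_j⁻¹` gives a solution.

Conversely, the coupling inequalities say that the `Q_j = X_j Y_j⁻¹` are positive definite and
increase strictly. Hence the matrix with blocks `Q_{min(i,j)}` is positive definite, which gives an
`𝒳` mapping the rows `(Y; V)` to `(X; U)`. In these coordinates the projection lemma yields `S_ν`:
its two conditions are the inequality with index `ν + 1` and the projected inequality with index
`ν`.
-/

noncomputable section

namespace NestedHinf

/-! ### Definiteness of real matrices -/

section Definite

variable {a b : Type} [Fintype a]

lemma posDef_iff {M : Matrix a a ℝ} :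
    M.PosDef ↔ M.IsSymm ∧ ∀ x : a → ℝ, x ≠ 0 → 0 < x ⬝ᵥ M *ᵥ x := by
  simp [Matrix.posDef_iff_dotProduct_mulVec, Matrix.IsHermitian, Matrix.IsSymm,
    Matrix.conjTranspose_eq_transpose_of_trivial]

lemma dotProduct_mulVec_nonneg {M : Matrix a a ℝ} (hM : M.PosDef) (x : a → ℝ) :
    0 ≤ x ⬝ᵥ M *ᵥ x :=
  hM.posSemidef.dotProduct_mulVec_nonneg x

lemma dotProduct_mulVec_comm {M : Matrix a a ℝ} (hM : M.IsSymm) (x y : a → ℝ) :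
    x ⬝ᵥ M *ᵥ y = y ⬝ᵥ M *ᵥ x := by
  rw [← Matrix.dotProduct_transpose_mulVec, hM.eq]

lemma isSymm_of_dotProduct_mulVec_comm {M : Matrix a a ℝ}
    (h : ∀ x y, x ⬝ᵥ M *ᵥ y = y ⬝ᵥ M *ᵥ x) : M.IsSymm := by
  refine Matrix.ext_iff_mulVec.2 fun v => dotProduct_eq _ _ fun u => ?_
  rw [dotProduct_comm, Matrix.dotProduct_transpose_mulVec, dotProduct_comm (M *ᵥ v), h]

lemma dotProduct_he_mulVec (M : Matrix a a ℝ) (x : a → ℝ) :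
    x ⬝ᵥ He M *ᵥ x = 2 * (x ⬝ᵥ M *ᵥ x) := by
  rw [He, Matrix.add_mulVec, dotProduct_add, Matrix.dotProduct_transpose_mulVec, two_mul]

lemma isSymm_he {a : Type} (M : Matrix a a ℝ) : (He M).IsSymm := by
  simp [Matrix.IsSymm, He, add_comm]

lemma negDef_he_iff {M : Matrix a a ℝ} :
    NegDef (He M) ↔ ∀ x : a → ℝ, x ≠ 0 → x ⬝ᵥ M *ᵥ x < 0 := by
  simp [NegDef, posDef_iff, (isSymm_he M).neg, Matrix.neg_mulVec, dotProduct_he_mulVec,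
    mul_neg_iff, (two_pos (α := ℝ)).not_gt]

lemma he_congr (K : Matrix a b ℝ) (M : Matrix a a ℝ) :
    He (Kᵀ * M * K) = Kᵀ * He M * K := by
  simp only [He, Matrix.transpose_mul, Matrix.transpose_transpose, Matrix.mul_add,
    Matrix.add_mul, Matrix.mul_assoc]

/-- Strict negativity of the quadratic form of `M` on a subspace: for a basis matrix `K` of `S`, it
says that the congruence `Kᵀ M K` is negative definite. `M` need not be symmetric. -/
def NegOn (M : Matrix a a ℝ) (S : Submodule ℝ (a → ℝ)) : Prop :=
  ∀ z ∈ S, z ≠ 0 → z ⬝ᵥ M *ᵥ z < 0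

variable [Fintype b]

lemma dotProduct_mul_mul_mulVec {a' b' : Type} [Fintype a'] [Fintype b'] (L : Matrix a b ℝ)
    (M : Matrix b b' ℝ) (R : Matrix b' a' ℝ) (x : a → ℝ) (y : a' → ℝ) :
    x ⬝ᵥ (L * M * R) *ᵥ y = (Lᵀ *ᵥ x) ⬝ᵥ M *ᵥ (R *ᵥ y) := by
  rw [← Matrix.mulVec_mulVec, ← Matrix.mulVec_mulVec, Matrix.dotProduct_mulVec,
    Matrix.mulVec_transpose]

lemma IsBasisMatrix.mulVec_ne_zero {a : Type} {K : Matrix a b ℝ} {S : Submodule ℝ (a → ℝ)}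
    (hK : IsBasisMatrix K S) {x : b → ℝ} (hx : x ≠ 0) : K *ᵥ x ≠ 0 := fun h =>
  hx (Matrix.mulVec_injective_iff.2 hK.1 (h.trans (Matrix.mulVec_zero K).symm))

lemma IsBasisMatrix.mulVec_mem {a : Type} {K : Matrix a b ℝ} {S : Submodule ℝ (a → ℝ)}
    (hK : IsBasisMatrix K S) (x : b → ℝ) : K *ᵥ x ∈ S := by
  rw [← hK.2]
  exact ⟨x, rfl⟩

lemma IsBasisMatrix.negDef_he_iff {K : Matrix a b ℝ} {S : Submodule ℝ (a → ℝ)}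
    (hK : IsBasisMatrix K S) {M : Matrix a a ℝ} :
    NegDef (He (Kᵀ * M * K)) ↔ NegOn M S := by
  simp only [NestedHinf.negDef_he_iff, dotProduct_mul_mul_mulVec, Matrix.transpose_transpose]
  refine ⟨fun h z hz hz0 => ?_, fun h x hx => h _ (hK.mulVec_mem x) (hK.mulVec_ne_zero hx)⟩
  rw [← hK.2] at hz
  obtain ⟨x, rfl⟩ := hz
  refine h x fun hx => hz0 ?_
  rw [hx, map_zero]

lemma exists_isBasisMatrix {a : Type} [Finite a] (S : Submodule ℝ (a → ℝ)) :
    ∃ (h : ℕ) (K : Matrix a (Fin h) ℝ), IsBasisMatrix K S := by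
  let B := Module.finBasis ℝ S
  refine ⟨_, Matrix.of fun i j => (B j : a → ℝ) i, ?_, ?_⟩
  · exact B.linearIndependent.map' S.subtype (Submodule.ker_subtype S)
  · have hr : Set.range (Matrix.of fun i j => (B j : a → ℝ) i).col =
        S.subtype '' Set.range B := by
      rw [← Set.range_comp]
      rfl
    rw [Matrix.range_mulVecLin, hr, Submodule.span_image, B.span_eq, Submodule.map_top,
      Submodule.range_subtype]

lemma NegOn.eventually {ι : Type*} [TopologicalSpace ι] {t₀ : ι} {f : ι → Matrix a a ℝ}
    {S : Submodule ℝ (a → ℝ)} (h : NegOn (f t₀) S) (hf : ContinuousAt f t₀) :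
    ∀ᶠ t in nhds t₀, NegOn (f t) S := by
  have hK : IsCompact ((S : Set (a → ℝ)) ∩ Metric.sphere 0 1) :=
    (isCompact_sphere 0 1).inter_left S.closed_of_finiteDimensional
  have hsphere : ∀ᶠ t in nhds t₀, ∀ z ∈ (S : Set (a → ℝ)) ∩ Metric.sphere 0 1,
      z ⬝ᵥ f t *ᵥ z < 0 := by
    refine hK.eventually_forall_of_forall_eventually fun z hz => ?_
    have hform : Continuous fun q : Matrix a a ℝ × (a → ℝ) => q.2 ⬝ᵥ q.1 *ᵥ q.2 := by fun_prop
    have hpair : ContinuousAt (fun q : ι × (a → ℝ) => (f q.1, q.2)) (t₀, z) :=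
      (ContinuousAt.comp (f := Prod.fst) (x := (t₀, z)) hf continuousAt_fst).prodMk
        continuousAt_snd
    exact (hform.continuousAt.comp hpair).eventually_lt continuousAt_const
      (h z hz.1 (ne_zero_of_mem_unit_sphere ⟨z, hz.2⟩))
  filter_upwards [hsphere] with t ht z hz hz0
  have hn : 0 < ‖z‖⁻¹ := inv_pos.2 (norm_pos_iff.2 hz0)
  have := ht (‖z‖⁻¹ • z) ⟨S.smul_mem _ hz, by simp [norm_smul, norm_ne_zero_iff.2 hz0]⟩
  rw [Matrix.mulVec_smul, smul_dotProduct, dotProduct_smul, smul_eq_mul, smul_eq_mul] at this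
  exact neg_of_mul_neg_right (neg_of_mul_neg_right this hn.le) hn.le

end Definite

/-! ### The projection lemma -/

section LinearAlgebra

variable {𝕜 V W : Type*} [Field 𝕜] [AddCommGroup V] [Module 𝕜 V] [AddCommGroup W] [Module 𝕜 W]

lemma exists_generalized_inverse (f : V →ₗ[𝕜] W) : ∃ g : W →ₗ[𝕜] V, ∀ v, f (g (f v)) = f v := by
  obtain ⟨s, hs⟩ := LinearMap.exists_rightInverse_of_surjective f.rangeRestrict
    (LinearMap.range_rangeRestrict f)
  obtain ⟨g, hg⟩ := LinearMap.exists_extend s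
  refine ⟨g, fun v => ?_⟩
  have hgs : g (f v) = s (f.rangeRestrict v) := LinearMap.congr_fun hg (f.rangeRestrict v)
  rw [hgs]
  exact congrArg Subtype.val (LinearMap.congr_fun hs (f.rangeRestrict v))

lemma exists_extend_eq_zero_on (U₁ U₂ : Submodule 𝕜 V) (f : U₁ →ₗ[𝕜] W)
    (hf : ∀ x : U₁, (x : V) ∈ U₂ → f x = 0) :
    ∃ g : V →ₗ[𝕜] W, (∀ x : U₁, g x = f x) ∧ ∀ x ∈ U₂, g x = 0 := by
  obtain ⟨s, hs⟩ := exists_generalized_inverse (U₂.mkQ ∘ₗ U₁.subtype)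
  refine ⟨f ∘ₗ s ∘ₗ U₂.mkQ, fun x => ?_, fun x hx => ?_⟩
  · have hx : (s (U₂.mkQ x) - x : V) ∈ U₂ := (Submodule.Quotient.eq U₂).1 (hs x)
    exact sub_eq_zero.1 ((map_sub f _ _).symm.trans (hf (s (U₂.mkQ x) - x) hx))
  · simp [(Submodule.Quotient.mk_eq_zero U₂).2 hx]

lemma exists_complementary_projection {U₁ U₂ : Submodule 𝕜 V} {P : V →ₗ[𝕜] V}
    (hP : LinearMap.IsProj (U₁ ⊓ U₂) P) :
    ∃ π : V →ₗ[𝕜] V, (∀ v, π v ∈ U₁) ∧ (∀ v, P (π v) = 0) ∧ (∀ v ∈ U₁, π v = v - P v) ∧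
      ∀ v ∈ U₂, π v = 0 := by
  have hmem : ∀ v : U₁, (v : V) - P v ∈ U₁ ⊓ LinearMap.ker P := fun v =>
    ⟨U₁.sub_mem v.2 (hP.map_mem v).1, by simp [hP.map_id _ (hP.map_mem v)]⟩
  obtain ⟨g, hg₁, hg₂⟩ := exists_extend_eq_zero_on U₁ U₂
    (LinearMap.codRestrict _ ((LinearMap.id - P) ∘ₗ U₁.subtype) hmem) fun x hx =>
      Subtype.ext (sub_eq_zero.2 (hP.map_id x ⟨x.2, hx⟩).symm)
  exact ⟨Submodule.subtype _ ∘ₗ g, fun v => (g v).2.1, fun v => (g v).2.2,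
    fun v hv => congrArg Subtype.val (hg₁ ⟨v, hv⟩), fun v hv => congrArg Subtype.val (hg₂ v hv)⟩

lemma bilin_add_four {H : LinearMap.BilinForm 𝕜 V} (hH : H.IsSymm) {w₀ w₁ w₂ w₃ : V}
    (h₁ : H w₀ w₁ = 0) (h₂ : H w₀ w₂ = 0) (h₃ : H w₀ w₃ = 0) :
    H (w₀ + w₁ + w₂ + w₃) (w₀ + w₁ + w₂ + w₃) = H w₀ w₀ + H w₁ w₁ + H w₂ w₂ + H w₃ w₃ +
      2 * (H w₁ w₂ + H w₁ w₃ + H w₃ w₂) := by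
  simp only [map_add, LinearMap.add_apply, h₁, h₂, h₃, hH.eq w₁ w₀, hH.eq w₂ w₀, hH.eq w₃ w₀,
    hH.eq w₂ w₁, hH.eq w₃ w₁, hH.eq w₂ w₃]
  ring

lemma exists_orthogonal_projection [FiniteDimensional 𝕜 V] {H : LinearMap.BilinForm 𝕜 V}
    (hH : H.IsSymm) {U : Submodule 𝕜 V} (hU : ∀ u ∈ U, H u u = 0 → u = 0) :
    ∃ P : V →ₗ[𝕜] V, LinearMap.IsProj U P ∧ ∀ u ∈ U, ∀ v, P v = 0 → H u v = 0 := by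
  have hd : Disjoint U (H.orthogonal U) :=
    Submodule.disjoint_def.2 fun x hx hx' => hU x hx (hx' x hx)
  have hc : IsCompl U (H.orthogonal U) :=
    (LinearMap.BilinForm.isCompl_orthogonal_iff_disjoint hH.isRefl).2 hd
  refine ⟨U.subtype ∘ₗ U.projectionOnto _ hc, ⟨fun v => (U.projectionOnto _ hc v).2,
    fun u hu => congrArg Subtype.val (Submodule.projectionOnto_apply_left hc ⟨u, hu⟩)⟩,
    fun u hu v hv => ?_⟩
  exact (Submodule.projectionOnto_apply_eq_zero_iff hc).1 (Subtype.ext hv) u hu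

variable [LinearOrder 𝕜] [IsStrictOrderedRing 𝕜]

lemma sum_bilin_neg {ι : Type*} [Fintype ι] {Q : ι → LinearMap.BilinForm 𝕜 V} {w : ι → V}
    (hQ : ∀ i, w i ≠ 0 → Q i (w i) (w i) < 0) (hw : ∑ i, w i ≠ 0) :
    ∑ i, Q i (w i) (w i) < 0 := by
  obtain ⟨i, hi, hwi⟩ := Finset.exists_ne_zero_of_sum_ne_zero hw
  refine Finset.sum_neg' (fun j _ => ?_) ⟨i, hi, hQ i hwi⟩
  rcases eq_or_ne (w j) 0 with hj | hj
  · simp [hj]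
  · exact (hQ j hj).le

/- Split `v` into its `H`-orthogonal projection onto `U₁ ⊓ U₂`, parts in `U₁` and `U₂` that are
defined for all `v`, and a remainder that vanishes on `U₁` and on `U₂`; `β` cancels every cross term
and makes the remainder contribute `-G`. -/
lemma exists_bilin_neg [FiniteDimensional 𝕜 V] {H G : LinearMap.BilinForm 𝕜 V} (hH : H.IsSymm)
    (hG : ∀ v, v ≠ 0 → 0 < G v v) {U₁ U₂ : Submodule 𝕜 V}
    (h₁ : ∀ u ∈ U₁, u ≠ 0 → H u u < 0) (h₂ : ∀ u ∈ U₂, u ≠ 0 → H u u < 0) :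
    ∃ β : LinearMap.BilinForm 𝕜 V, (∀ u ∈ U₂, ∀ v, β u v = 0) ∧ (∀ v ∈ U₁, ∀ u, β u v = 0) ∧
      ∀ v, v ≠ 0 → H v v + 2 * β v v < 0 := by
  obtain ⟨P, hP, hPo⟩ := exists_orthogonal_projection hH (U := U₁ ⊓ U₂) fun u hu h =>
    of_not_not fun h0 => (h₁ u hu.1 h0).ne h
  obtain ⟨π₁, hm₁, hP₁, hi₁, hz₁⟩ := exists_complementary_projection hP
  obtain ⟨π₂, hm₂, hP₂, hi₂, hz₂⟩ := exists_complementary_projection (inf_comm U₁ U₂ ▸ hP)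
  let π₃ : V →ₗ[𝕜] V := LinearMap.id - P - π₁ - π₂
  have hπ₃ : ∀ v, π₃ v = v - P v - π₁ v - π₂ v := fun v => rfl
  have hP₃ : ∀ v, P (π₃ v) = 0 := fun v => by
    simp only [hπ₃, map_sub, hP.map_id _ (hP.map_mem v), hP₁, hP₂, sub_self]
  refine ⟨-(H.compl₁₂ π₁ π₂) - H.compl₁₂ π₁ π₃ - H.compl₁₂ π₃ π₂
      - (1 / 2 : 𝕜) • (H.compl₁₂ π₃ π₃ + G.compl₁₂ π₃ π₃), fun u hu v => ?_, fun v hv u => ?_,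
    fun v hv => ?_⟩
  · simp [hπ₃, hz₁ u hu, hi₂ u hu]
  · simp [hπ₃, hz₂ v hv, hi₁ v hv]
  have hsum : v = P v + π₁ v + π₂ v + π₃ v := by rw [hπ₃]; abel
  have hform : H v v + 2 * (-H (π₁ v) (π₂ v) - H (π₁ v) (π₃ v) - H (π₃ v) (π₂ v)
      - 1 / 2 * (H (π₃ v) (π₃ v) + G (π₃ v) (π₃ v))) =
      H (P v) (P v) + H (π₁ v) (π₁ v) + H (π₂ v) (π₂ v) - G (π₃ v) (π₃ v) := by
    have := bilin_add_four hH (hPo _ (hP.map_mem v) _ (hP₁ v)) (hPo _ (hP.map_mem v) _ (hP₂ v))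
      (hPo _ (hP.map_mem v) _ (hP₃ v))
    rw [← hsum] at this
    rw [this]
    ring
  have hneg := sum_bilin_neg (Q := ![H, H, H, -G]) (w := ![P v, π₁ v, π₂ v, π₃ v])
    (by
      simp only [Fin.forall_fin_succ, IsEmpty.forall_iff, and_true]
      exact ⟨h₁ _ (hP.map_mem v).1, h₁ _ (hm₁ v), h₂ _ (hm₂ v), fun h => neg_neg_of_pos (hG _ h)⟩)
    (by simpa [Fin.sum_univ_four, ← hsum] using hv)
  exact hform.trans_lt (by simpa [Fin.sum_univ_four, sub_eq_add_neg] using hneg)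

end LinearAlgebra

section MatrixProjection

variable {a b c : Type} [Fintype a] [Fintype b] [Fintype c]

lemma exists_mul_mul_eq_self {a' : Type} (T : Matrix a' a ℝ) (N : Matrix c a ℝ)
    (h : ∀ v, N *ᵥ v = 0 → T *ᵥ v = 0) :
    ∃ R : Matrix a c ℝ, T * R * N = T := by
  classical
  obtain ⟨g, hg⟩ := exists_generalized_inverse N.mulVecLin
  refine ⟨LinearMap.toMatrix' g, Matrix.mulVec_injective (funext fun v => ?_)⟩
  have hker : T *ᵥ (g (N *ᵥ v) - v) = 0 :=
    h _ (by rw [Matrix.mulVec_sub, sub_eq_zero]; exact hg v)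
  rw [← Matrix.mulVec_mulVec, ← Matrix.mulVec_mulVec, LinearMap.toMatrix'_mulVec]
  exact sub_eq_zero.1 ((Matrix.mulVec_sub T _ _).symm.trans hker)

lemma exists_eq_mul_mul {T : Matrix a a ℝ} {M : Matrix a b ℝ} {N : Matrix c a ℝ}
    (hN : ∀ v, N *ᵥ v = 0 → T *ᵥ v = 0) (hM : ∀ u, Mᵀ *ᵥ u = 0 → Tᵀ *ᵥ u = 0) :
    ∃ S : Matrix b c ℝ, T = M * S * N := by
  classical
  obtain ⟨R, hR⟩ := exists_mul_mul_eq_self T N hN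
  obtain ⟨L, hL⟩ := exists_mul_mul_eq_self Tᵀ Mᵀ hM
  have hL' : M * Lᵀ * T = T := by
    simpa only [Matrix.transpose_mul, Matrix.transpose_transpose, Matrix.mul_assoc]
      using congrArg Matrix.transpose hL
  exact ⟨Lᵀ * T * R, by simp only [← Matrix.mul_assoc, hL', hR]⟩

lemma projection_lemma {Q : Matrix a a ℝ} {M : Matrix a b ℝ} {N : Matrix c a ℝ}
    (hN : NegOn Q (ker N)) (hM : NegOn Q (ker Mᵀ)) :
    ∃ S : Matrix b c ℝ, NegOn (Q + M * S * N) ⊤ := by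
  classical
  have hform : ∀ (A : Matrix a a ℝ) u v, Matrix.toLinearMap₂' ℝ A u v = u ⬝ᵥ A *ᵥ v :=
    fun A u v => Matrix.toLinearMap₂'_apply' A u v
  have hneg : ∀ {U : Submodule ℝ (a → ℝ)}, NegOn Q U → ∀ u ∈ U, u ≠ 0 →
      Matrix.toLinearMap₂' ℝ (He Q) u u < 0 := fun h u hu h0 => by
    rw [hform, dotProduct_he_mulVec]
    linarith [h u hu h0]
  obtain ⟨β, hβ₂, hβ₁, hβ⟩ := exists_bilin_neg
    (H := Matrix.toLinearMap₂' ℝ (He Q)) (G := Matrix.toLinearMap₂' ℝ (1 : Matrix a a ℝ))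
    ⟨fun u v => by rw [hform, hform]; exact dotProduct_mulVec_comm (isSymm_he Q) u v⟩
    (fun v hv => by
      rw [hform, Matrix.one_mulVec]
      exact Matrix.dotProduct_star_self_pos_iff.2 hv)
    (hneg hN) (hneg hM)
  let T : Matrix a a ℝ := LinearMap.toMatrix₂' ℝ β
  have hT : ∀ u v, u ⬝ᵥ T *ᵥ v = β u v := fun u v => by
    rw [← hform, Matrix.toLinearMap₂'_toMatrix']
  obtain ⟨S, hS⟩ : ∃ S : Matrix b c ℝ, T = M * S * N := by
    refine exists_eq_mul_mul (fun v hv => dotProduct_eq_zero _ fun u => ?_)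
      fun u hu => dotProduct_eq_zero _ fun v => ?_
    · rw [dotProduct_comm, hT, hβ₁ v hv]
    · rw [dotProduct_comm, Matrix.dotProduct_transpose_mulVec, hT, hβ₂ u hu]
  refine ⟨S, fun z _ hz => ?_⟩
  have := hβ z hz
  rw [hform, dotProduct_he_mulVec, ← hT] at this
  rw [← hS, Matrix.add_mulVec, dotProduct_add]
  linarith

lemma exists_negOn_add_mul_mul {Q : Matrix a a ℝ} {M : Matrix a b ℝ} {N : Matrix c a ℝ}
    {U : Submodule ℝ (a → ℝ)} (hN : NegOn Q (U ⊓ ker N)) (hM : NegOn Q (U ⊓ ker Mᵀ)) :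
    ∃ S : Matrix b c ℝ, NegOn (Q + M * S * N) U := by
  obtain ⟨h, K, hK⟩ := exists_isBasisMatrix U
  have hneg : ∀ {d : Type} (R : Matrix d a ℝ), NegOn Q (U ⊓ ker R) →
      NegOn (Kᵀ * Q * K) (ker (R * K)) := fun R hR x hx hx0 => by
    rw [dotProduct_mul_mul_mulVec, Matrix.transpose_transpose]
    exact hR _ ⟨hK.mulVec_mem x, (Matrix.mulVec_mulVec x R K).trans hx⟩ (hK.mulVec_ne_zero hx0)
  obtain ⟨S, hS⟩ := projection_lemma (M := Kᵀ * M) (hneg N hN)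
    (by simpa only [Matrix.transpose_mul, Matrix.transpose_transpose] using hneg Mᵀ hM)
  refine ⟨S, hK.negDef_he_iff.1 (negDef_he_iff.2 fun x hx => ?_)⟩
  have hsplit : Kᵀ * (Q + M * S * N) * K = Kᵀ * Q * K + Kᵀ * M * S * (N * K) := by
    simp only [Matrix.mul_add, Matrix.add_mul, Matrix.mul_assoc]
  rw [hsplit]
  exact hS x trivial hx

end MatrixProjection

/-! ### Dissipation forms -/

section DissipationForm

variable {a b c : Type} [Fintype a] [Fintype b] [Fintype c]

/-- Half of the quadratic form of a bounded-real inequality for the system `(A, B, C, D)`. The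
costate `q`, which is `𝒳 x` for a certificate `𝒳`, is an independent argument. -/
def dissForm (A : Matrix a a ℝ) (B : Matrix a b ℝ) (C : Matrix c a ℝ) (D : Matrix c b ℝ) (γ : ℝ)
    (q x : a → ℝ) (d : b → ℝ) (e : c → ℝ) : ℝ :=
  q ⬝ᵥ (A *ᵥ x + B *ᵥ d) + e ⬝ᵥ (C *ᵥ x + D *ᵥ d) - γ / 2 * (d ⬝ᵥ d) - γ / 2 * (e ⬝ᵥ e)

/-- The matrix of `dissForm` in the variables `(v, d, e)` for `q = X v` and `x = Y v`. -/
def dissMat {a' b c : Type} [DecidableEq b] [DecidableEq c]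
    (A : Matrix a a ℝ) (B : Matrix a b ℝ) (C : Matrix c a ℝ) (D : Matrix c b ℝ) (γ : ℝ)
    (X Y : Matrix a a' ℝ) : Matrix (a' ⊕ (b ⊕ c)) (a' ⊕ (b ⊕ c)) ℝ :=
  block3 (Xᵀ * A * Y) (Xᵀ * B) 0 0 (-((γ / 2) • 1)) 0 (C * Y) D (-((γ / 2) • 1))

lemma dotProduct_dissMat_mulVec {a' : Type} [Fintype a'] [DecidableEq b] [DecidableEq c]
    (A : Matrix a a ℝ) (B : Matrix a b ℝ) (C : Matrix c a ℝ) (D : Matrix c b ℝ) (γ : ℝ)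
    (X Y : Matrix a a' ℝ) (v : a' → ℝ) (d : b → ℝ) (e : c → ℝ) :
    Sum.elim v (Sum.elim d e) ⬝ᵥ dissMat A B C D γ X Y *ᵥ Sum.elim v (Sum.elim d e) =
      dissForm A B C D γ (X *ᵥ v) (Y *ᵥ v) d e := by
  simp only [dissMat, block3, Matrix.fromBlocks_mulVec, Matrix.fromRows_mulVec,
    Matrix.fromCols_mulVec, Sum.elim_comp_inl, Sum.elim_comp_inr, ← Sum.elim_add_add,
    sumElim_dotProduct_sumElim, Matrix.zero_mulVec, Matrix.neg_mulVec, Matrix.smul_mulVec,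
    Matrix.one_mulVec, Matrix.mul_assoc, ← Matrix.mulVec_mulVec, dotProduct_add, dotProduct_neg,
    dotProduct_smul, dotProduct_zero, smul_eq_mul, Matrix.dotProduct_transpose_mulVec, dissForm]
  rw [dotProduct_comm (A *ᵥ _), dotProduct_comm (B *ᵥ _)]
  ring

lemma he_dissMat {a' b c : Type} [DecidableEq b] [DecidableEq c]
    (A : Matrix a a ℝ) (B : Matrix a b ℝ) (C : Matrix c a ℝ) (D : Matrix c b ℝ) (γ : ℝ)
    (X Y : Matrix a a' ℝ) :
    He (dissMat A B C D γ X Y) = block3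
      ((Xᵀ * A * Y)ᵀ + Xᵀ * A * Y) (Xᵀ * B)   (Yᵀ * Cᵀ)
      (Bᵀ * X)                     (-(γ • 1)) Dᵀ
      (C * Y)                      D          (-(γ • 1)) := by
  have hsmul : ∀ {b : Type} [DecidableEq b],
      (-((γ / 2) • 1) : Matrix b b ℝ)ᵀ + -((γ / 2) • 1) = -(γ • 1) := fun {b} _ => by
    rw [Matrix.transpose_neg, Matrix.transpose_smul, Matrix.transpose_one, ← neg_add, ← add_smul,
      add_halves]
  simp only [He, dissMat, block3, Matrix.fromBlocks_transpose, Matrix.transpose_fromCols,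
    Matrix.transpose_fromRows, Matrix.fromBlocks_add, Matrix.transpose_mul,
    Matrix.transpose_transpose, Matrix.transpose_zero, hsmul, zero_add, add_zero]
  congr 1
  · ext i (j | j) <;> simp
  · ext (i | i) j <;> simp

lemma continuousAt_dissMat {ι : Type*} [TopologicalSpace ι] {a' b c : Type} [DecidableEq b]
    [DecidableEq c] {A : Matrix a a ℝ} {B : Matrix a b ℝ} {C : Matrix c a ℝ} {D : Matrix c b ℝ}
    {γ : ι → ℝ} {X Y : ι → Matrix a a' ℝ} {t : ι} (hγ : ContinuousAt γ t) (hX : ContinuousAt X t)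
    (hY : ContinuousAt Y t) :
    ContinuousAt (fun t => dissMat A B C D (γ t) (X t) (Y t)) t := by
  have hdiss : Continuous fun s : ℝ × Matrix a a' ℝ × Matrix a a' ℝ =>
      dissMat A B C D s.1 s.2.1 s.2.2 := by
    refine continuous_matrix ?_
    rintro (i | i | i) (j | j | j) <;>
      simp only [dissMat, block3, Matrix.fromBlocks_apply₁₁, Matrix.fromBlocks_apply₁₂,
        Matrix.fromBlocks_apply₂₁, Matrix.fromBlocks_apply₂₂, Matrix.fromCols_apply_inl,
        Matrix.fromCols_apply_inr, Matrix.fromRows_apply_inl, Matrix.fromRows_apply_inr,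
        Matrix.neg_apply, Matrix.smul_apply, smul_eq_mul] <;>
      fun_prop
  exact ContinuousAt.comp (f := fun t => (γ t, X t, Y t)) hdiss.continuousAt
    (hγ.prodMk (hX.prodMk hY))

lemma sumElim_ne_zero_iff {a b : Type} {x : a → ℝ} {y : b → ℝ} :
    Sum.elim x y ≠ 0 ↔ x ≠ 0 ∨ y ≠ 0 := by
  rw [← not_and_or, not_iff_not, ← Sum.elim_zero_zero, Sum.elim_eq_iff]

lemma negOn_sum_iff {M : Matrix (a ⊕ (b ⊕ c)) (a ⊕ (b ⊕ c)) ℝ}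
    {S : Submodule ℝ (a ⊕ (b ⊕ c) → ℝ)} :
    NegOn M S ↔ ∀ v d e, v ≠ 0 ∨ d ≠ 0 ∨ e ≠ 0 → Sum.elim v (Sum.elim d e) ∈ S →
      Sum.elim v (Sum.elim d e) ⬝ᵥ M *ᵥ Sum.elim v (Sum.elim d e) < 0 := by
  refine ⟨fun h v d e h0 hS => h _ hS ?_, fun h z hz hz0 => ?_⟩
  · rwa [sumElim_ne_zero_iff, sumElim_ne_zero_iff]
  · rw [← Sum.elim_comp_inl_inr z, ← Sum.elim_comp_inl_inr (z ∘ Sum.inr)] at hz hz0 ⊢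
    rw [sumElim_ne_zero_iff, sumElim_ne_zero_iff] at hz0
    exact h _ _ _ hz0 hz

lemma sumElim_mem_ker_iff {r s : Type}
    {M₁₁ : Matrix r a ℝ} {M₁₂ : Matrix r b ℝ} {M₁₃ : Matrix r c ℝ}
    {M₂₁ : Matrix s a ℝ} {M₂₂ : Matrix s b ℝ} {M₂₃ : Matrix s c ℝ}
    {v : a → ℝ} {d : b → ℝ} {e : c → ℝ} :
    Sum.elim v (Sum.elim d e) ∈
        ker (Matrix.fromBlocks M₁₁ (Matrix.fromCols M₁₂ M₁₃) M₂₁ (Matrix.fromCols M₂₂ M₂₃)) ↔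
      M₁₁ *ᵥ v + (M₁₂ *ᵥ d + M₁₃ *ᵥ e) = 0 ∧ M₂₁ *ᵥ v + (M₂₂ *ᵥ d + M₂₃ *ᵥ e) = 0 := by
  rw [ker, LinearMap.mem_ker, Matrix.mulVecLin_apply, Matrix.fromBlocks_mulVec,
    Sum.elim_comp_inl, Sum.elim_comp_inr, Matrix.fromCols_mulVec, Matrix.fromCols_mulVec,
    Sum.elim_comp_inl, Sum.elim_comp_inr, ← Sum.elim_zero_zero, Sum.elim_eq_iff]

end DissipationForm

lemma transpose_submatrix_one_mulVec {a b : Type} [Fintype a] [DecidableEq a] (f : b → a)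
    (w : a → ℝ) : ((1 : Matrix a a ℝ).submatrix id f)ᵀ *ᵥ w = w ∘ f := by
  ext i
  simp [Matrix.mulVec, dotProduct, Matrix.one_apply]

section Plant

variable {p : ℕ} {n k m : Fin p → ℕ} {nd ne : ℕ} (P : Plant n k m nd ne)

/-- The signal `Bᵀ q + Eᵀ e`, dual to the measured output, that the control input `u` is paired with
in the dissipation form: `q ⬝ B u + e ⬝ E u = coInput P q e ⬝ u`. -/
def coInput (q : Idx n → ℝ) (e : Fin ne → ℝ) : Idx m → ℝ := P.Bᵀ *ᵥ q + P.Eᵀ *ᵥ e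

/-- The measured output `C x + F d`. -/
def measOut (x : Idx n → ℝ) (d : Fin nd → ℝ) : Idx k → ℝ := P.C *ᵥ x + P.F *ᵥ d

/-- The dissipation form of the uncontrolled plant. -/
abbrev plantForm (γ : ℝ) (q x : Idx n → ℝ) (d : Fin nd → ℝ) (e : Fin ne → ℝ) : ℝ :=
  dissForm P.A P.B₀ P.C₀ P.D₀ γ q x d e

lemma mem_gammaSpace {j : Fin (p + 1)} {v : Idx n → ℝ} {d : Fin nd → ℝ} {e : Fin ne → ℝ} :
    Sum.elim v (Sum.elim d e) ∈ gammaSpace P j ↔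
      (∀ a : Idx k, a.1.val < j.val → measOut P v d a = 0) ∧
      (∀ b : Idx m, ¬ b.1.val < j.val → coInput P v e b = 0) := by
  rw [gammaSpace, sumElim_mem_ker_iff]
  simp only [← Matrix.mulVec_mulVec, Matrix.zero_mulVec, add_zero, zero_add, selLc, selL,
    transpose_submatrix_one_mulVec, funext_iff, Subtype.forall]
  rfl

/-- The projected inequality with index `j` for the pair `(X, Y)`, as a statement on the plant
form. -/
def ProjNeg (γ : ℝ) (X Y : Matrix (Idx n) (Idx n) ℝ) (j : Fin (p + 1)) : Prop :=
  ∀ v d e, v ≠ 0 ∨ d ≠ 0 ∨ e ≠ 0 →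
    (∀ a : Idx k, a.1.val < j.val → measOut P v d a = 0) →
    (∀ b : Idx m, ¬ b.1.val < j.val → coInput P v e b = 0) →
    plantForm P γ (X *ᵥ v) (Y *ᵥ v) d e < 0

variable {P} in
lemma projNeg_iff {γ : ℝ} {X Y : Matrix (Idx n) (Idx n) ℝ} {j : Fin (p + 1)} :
    ProjNeg P γ X Y j ↔ NegOn (dissMat P.A P.B₀ P.C₀ P.D₀ γ X Y) (gammaSpace P j) := by
  simp only [negOn_sum_iff, dotProduct_dissMat_mulVec, mem_gammaSpace, and_imp, ProjNeg]

variable {P} in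
lemma negDef_projected_iff {g : ℕ} {γ : ℝ} {X Y : Matrix (Idx n) (Idx n) ℝ} {j : Fin (p + 1)}
    {Γ : Matrix (Idx n ⊕ (Fin nd ⊕ Fin ne)) (Fin g) ℝ} (hΓ : IsBasisMatrix Γ (gammaSpace P j)) :
    NegDef (Γᵀ * block3
        ((Xᵀ * P.A * Y)ᵀ + Xᵀ * P.A * Y) (Xᵀ * P.B₀)  (Yᵀ * P.C₀ᵀ)
        (P.B₀ᵀ * X)                      (-(γ • 1))   P.D₀ᵀ
        (P.C₀ * Y)                       P.D₀         (-(γ • 1)) * Γ) ↔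
      ProjNeg P γ X Y j := by
  rw [← he_dissMat, ← he_congr, hΓ.negDef_he_iff, projNeg_iff]

end Plant

section ClosedLoopForm

variable {p : ℕ} {n k m : Fin p → ℕ} {nd ne : ℕ} {κ : Fin p → Type} [∀ i, Fintype (κ i)]
  (P : Plant n k m nd ne)

/-- The contribution of a controller with matrix `M = [D C; B A]` to the dissipation form of the
closed loop, where `(q, σ)` and `(x, ξ)` are the costate and the state. -/
def ctrlForm (M : Matrix (Idx m ⊕ Blk κ) (Idx k ⊕ Blk κ) ℝ) (q x : Idx n → ℝ) (σ ξ : Blk κ → ℝ)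
    (d : Fin nd → ℝ) (e : Fin ne → ℝ) : ℝ :=
  Sum.elim (coInput P q e) σ ⬝ᵥ M *ᵥ Sum.elim (measOut P x d) ξ

variable [∀ i, DecidableEq (κ i)]

lemma extC_mulVec_add_extF_mulVec (x : Idx n → ℝ) (ξ : Blk κ → ℝ) (d : Fin nd → ℝ) :
    extC P κ *ᵥ Sum.elim x ξ + extF P κ *ᵥ d = Sum.elim (measOut P x d) ξ := by
  simp only [extC, extF, Matrix.fromBlocks_mulVec, Matrix.fromRows_mulVec, Sum.elim_comp_inl,
    Sum.elim_comp_inr, ← Sum.elim_add_add, Matrix.zero_mulVec, Matrix.one_mulVec, add_zero,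
    zero_add, measOut]

lemma dotProduct_extB_mulVec_add (q : Idx n → ℝ) (σ : Blk κ → ℝ) (e : Fin ne → ℝ)
    (u : Idx m ⊕ Blk κ → ℝ) :
    Sum.elim q σ ⬝ᵥ extB P κ *ᵥ u + e ⬝ᵥ extE P κ *ᵥ u = Sum.elim (coInput P q e) σ ⬝ᵥ u := by
  rw [← Sum.elim_comp_inl_inr u]
  simp only [extB, extE, Matrix.fromBlocks_mulVec, Matrix.fromCols_mulVec, Sum.elim_comp_inl,
    Sum.elim_comp_inr, Matrix.zero_mulVec, Matrix.one_mulVec, add_zero, zero_add,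
    sumElim_dotProduct_sumElim, coInput, add_dotProduct]
  rw [dotProduct_comm (P.Bᵀ *ᵥ q), dotProduct_comm (P.Eᵀ *ᵥ e),
    Matrix.dotProduct_transpose_mulVec, Matrix.dotProduct_transpose_mulVec]
  ring

lemma dissForm_closedLoop (K : Controller κ k m) (γ : ℝ) (q x : Idx n → ℝ) (σ ξ : Blk κ → ℝ)
    (d : Fin nd → ℝ) (e : Fin ne → ℝ) :
    dissForm (clA P K) (clB P K) (clC P K) (clD P K) γ (Sum.elim q σ) (Sum.elim x ξ) d e =
      plantForm P γ q x d e + ctrlForm P K.mat q x σ ξ d e := by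
  have hstate : clA P K *ᵥ Sum.elim x ξ + clB P K *ᵥ d =
      Sum.elim (P.A *ᵥ x + P.B₀ *ᵥ d) 0 +
        extB P κ *ᵥ (K.mat *ᵥ Sum.elim (measOut P x d) ξ) := by
    simp only [← extC_mulVec_add_extF_mulVec, Matrix.mulVec_add, clA, clB, Matrix.add_mulVec,
      Matrix.fromBlocks_mulVec, Matrix.fromRows_mulVec, ← Matrix.mulVec_mulVec,
      Sum.elim_comp_inl, Sum.elim_comp_inr, Matrix.zero_mulVec, add_zero]
    rw [add_add_add_comm, ← Sum.elim_add_add, add_zero]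
  have houtput : clC P K *ᵥ Sum.elim x ξ + clD P K *ᵥ d =
      P.C₀ *ᵥ x + P.D₀ *ᵥ d + extE P κ *ᵥ (K.mat *ᵥ Sum.elim (measOut P x d) ξ) := by
    simp only [← extC_mulVec_add_extF_mulVec, Matrix.mulVec_add, clC, clD, Matrix.add_mulVec,
      Matrix.fromCols_mulVec, ← Matrix.mulVec_mulVec, Sum.elim_comp_inl, Sum.elim_comp_inr,
      Matrix.zero_mulVec, add_zero]
    rw [add_add_add_comm]
  rw [plantForm, dissForm, dissForm, hstate, houtput, dotProduct_add, dotProduct_add e,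
    sumElim_dotProduct_sumElim, dotProduct_zero, ctrlForm, ← dotProduct_extB_mulVec_add]
  ring

variable {P} in
lemma boundedRealLMI_iff {K : Controller κ k m} {γ : ℝ}
    {𝒳 : Matrix (Idx n ⊕ Blk κ) (Idx n ⊕ Blk κ) ℝ} :
    BoundedRealLMI P K γ 𝒳 ↔ 𝒳.PosDef ∧ ∀ z d e, z ≠ 0 ∨ d ≠ 0 ∨ e ≠ 0 →
      dissForm (clA P K) (clB P K) (clC P K) (clD P K) γ (𝒳 *ᵥ z) z d e < 0 := by
  refine and_congr_right fun hX => ?_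
  have hblock : block3
      ((clA P K)ᵀ * 𝒳 + 𝒳 * clA P K) (𝒳 * clB P K)  (clC P K)ᵀ
      ((clB P K)ᵀ * 𝒳)               (-(γ • 1))     (clD P K)ᵀ
      (clC P K)                      (clD P K)      (-(γ • 1)) =
      He (dissMat (clA P K) (clB P K) (clC P K) (clD P K) γ 𝒳 1) := by
    have hs : 𝒳ᵀ = 𝒳 := (posDef_iff.1 hX).1
    simp only [he_dissMat, Matrix.mul_one, Matrix.transpose_one, Matrix.one_mul,
      Matrix.transpose_mul, hs]
  rw [hblock, negDef_he_iff]
  have htop := negOn_sum_iff (M := dissMat (clA P K) (clB P K) (clC P K) (clD P K) γ 𝒳 1) (S := ⊤)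
  simpa only [NegOn, Submodule.mem_top, true_imp_iff, dotProduct_dissMat_mulVec,
    Matrix.one_mulVec] using htop

end ClosedLoopForm

/-! ### The step inequalities -/

section Step

variable {p : ℕ} {n k m : Fin p → ℕ} {nd ne : ℕ}

/-- The summand `diag(L_j, L_j) S_j diag(R_jᵀ, R_jᵀ)` of the controller matrix. -/
def Params.term (S : Params n k m) (j : Fin p) :
    Matrix (Idx m ⊕ Blk (KBlk n)) (Idx k ⊕ Blk (KBlk n)) ℝ :=
  Matrix.fromBlocks (selL (fun i => Fin (m i)) j.castSucc) 0 0 (selL (KBlk n) j.castSucc) *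
    S j * Matrix.fromBlocks (selR (fun i => Fin (k i)) j)ᵀ 0 0 (selR (KBlk n) j)ᵀ

/-- The part of the controller matrix that stems from the parameters with indices `j ≥ ν`. -/
def Params.tail (S : Params n k m) (ν : Fin (p + 1)) :
    Matrix (Idx m ⊕ Blk (KBlk n)) (Idx k ⊕ Blk (KBlk n)) ℝ :=
  ∑ j ∈ Finset.univ.filter fun j : Fin p => ν ≤ j.castSucc, S.term j

lemma Params.mat_controller (S : Params n k m) : S.controller.mat = S.tail 0 := by
  simp only [Params.controller, Controller.mat, Controller.ofMat, Matrix.fromBlocks_toBlocks,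
    Params.tail, Params.term, Fin.zero_le, Finset.filter_true]

variable (P : Plant n k m nd ne)

/-- The step inequality with index `ν`, as a statement on the plant and controller forms. Besides
the `p` inequalities of the construction this includes a terminal one, for `ν = p`. -/
def StepNeg (γ : ℝ) (W : DecVars n) (S : Params n k m) (ν : Fin (p + 1)) : Prop :=
  ∀ w d e, w ≠ 0 ∨ d ≠ 0 ∨ e ≠ 0 →
    (∀ a : Idx k, a.1.val < ν.val → measOut P (rowY W *ᵥ w) d a = 0) →
    (∀ b : Blk (KBlk n), b.1.val < ν.val → (rowV W *ᵥ w) b = 0) →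
    plantForm P γ (rowX W *ᵥ w) (rowY W *ᵥ w) d e +
      ctrlForm P (S.tail ν) (rowX W *ᵥ w) (rowY W *ᵥ w) (rowU n *ᵥ w) (rowV W *ᵥ w) d e < 0

lemma mem_kappaSpace {W : DecVars n} {ν : Fin p} {w : Ext n → ℝ} {d : Fin nd → ℝ}
    {e : Fin ne → ℝ} :
    Sum.elim w (Sum.elim d e) ∈ kappaSpace P W ν ↔
      (∀ a : Idx k, a.1.val < ν.val → measOut P (rowY W *ᵥ w) d a = 0) ∧
      (∀ b : Blk (KBlk n), b.1.val < ν.val → (rowV W *ᵥ w) b = 0) := by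
  rw [kappaSpace, ← Matrix.fromCols_zero, sumElim_mem_ker_iff]
  simp only [Matrix.mul_assoc, ← Matrix.mulVec_mulVec, Matrix.zero_mulVec, add_zero, selLc,
    transpose_submatrix_one_mulVec, funext_iff, Subtype.forall]
  rfl

lemma stepM_transpose_mulVec (W : DecVars n) (j : Fin p) (w : Ext n → ℝ) (d : Fin nd → ℝ)
    (e : Fin ne → ℝ) :
    (stepM P W j)ᵀ *ᵥ Sum.elim w (Sum.elim d e) =
      Sum.elim (fun b => coInput P (rowX W *ᵥ w) e b.1) (fun b => (rowU n *ᵥ w) b.1) := by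
  simp only [stepM, Matrix.fromBlocks_transpose, Matrix.transpose_fromRows,
    Matrix.fromBlocks_mulVec, Sum.elim_comp_inl, Sum.elim_comp_inr, Matrix.fromCols_mulVec,
    Matrix.transpose_mul, Matrix.transpose_transpose, Matrix.transpose_zero, Matrix.zero_mulVec,
    zero_add, add_zero, ← Matrix.mulVec_mulVec, selL, transpose_submatrix_one_mulVec]
  rfl

lemma stepN_mulVec (W : DecVars n) (j : Fin p) (w : Ext n → ℝ) (d : Fin nd → ℝ)
    (e : Fin ne → ℝ) :
    stepN P W j *ᵥ Sum.elim w (Sum.elim d e) =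
      Sum.elim (fun i => measOut P (rowY W *ᵥ w) d ⟨j, i⟩) (fun i => (rowV W *ᵥ w) ⟨j, i⟩) := by
  simp only [stepN, Matrix.fromBlocks_mulVec, Sum.elim_comp_inl, Sum.elim_comp_inr,
    Matrix.fromCols_mulVec, Matrix.mul_assoc, Matrix.zero_mulVec, add_zero,
    ← Matrix.mulVec_mulVec, selR, transpose_submatrix_one_mulVec]
  rfl

lemma ctrlForm_term (W : DecVars n) (S : Params n k m) (j : Fin p) (w : Ext n → ℝ)
    (d : Fin nd → ℝ) (e : Fin ne → ℝ) :
    Sum.elim w (Sum.elim d e) ⬝ᵥ (stepM P W j * S j * stepN P W j) *ᵥ Sum.elim w (Sum.elim d e) =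
      ctrlForm P (S.term j) (rowX W *ᵥ w) (rowY W *ᵥ w) (rowU n *ᵥ w) (rowV W *ᵥ w) d e := by
  rw [dotProduct_mul_mul_mulVec, stepM_transpose_mulVec, stepN_mulVec, ctrlForm, Params.term,
    dotProduct_mul_mul_mulVec]
  simp only [Matrix.fromBlocks_transpose, Matrix.fromBlocks_mulVec, Sum.elim_comp_inl,
    Sum.elim_comp_inr, Matrix.transpose_zero, Matrix.zero_mulVec, add_zero, zero_add, selL, selR,
    transpose_submatrix_one_mulVec]
  rfl

/-- The matrix of a step inequality before the projection; the controller terms have indices in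
`s`. -/
def stepMat (γ : ℝ) (W : DecVars n) (S : Params n k m) (s : Finset (Fin p)) :
    Matrix (Ext n ⊕ (Fin nd ⊕ Fin ne)) (Ext n ⊕ (Fin nd ⊕ Fin ne)) ℝ :=
  stepQ P γ W + ∑ j ∈ s, stepM P W j * S j * stepN P W j

lemma dotProduct_stepMat_mulVec (γ : ℝ) (W : DecVars n) (S : Params n k m) (s : Finset (Fin p))
    (w : Ext n → ℝ) (d : Fin nd → ℝ) (e : Fin ne → ℝ) :
    Sum.elim w (Sum.elim d e) ⬝ᵥ stepMat P γ W S s *ᵥ Sum.elim w (Sum.elim d e) =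
      plantForm P γ (rowX W *ᵥ w) (rowY W *ᵥ w) d e +
        ctrlForm P (∑ j ∈ s, S.term j) (rowX W *ᵥ w) (rowY W *ᵥ w) (rowU n *ᵥ w)
          (rowV W *ᵥ w) d e := by
  have hQ : stepQ P γ W = dissMat P.A P.B₀ P.C₀ P.D₀ γ (rowX W) (rowY W) := rfl
  rw [stepMat, Matrix.add_mulVec, dotProduct_add, hQ, dotProduct_dissMat_mulVec,
    Matrix.sum_mulVec, dotProduct_sum]
  simp only [ctrlForm_term]
  simp only [ctrlForm, Matrix.sum_mulVec, dotProduct_sum]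

lemma stepLMI_iff_negOn {γ : ℝ} {W : DecVars n} {h : Fin p → ℕ}
    {Kb : ∀ ν, Matrix (Ext n ⊕ (Fin nd ⊕ Fin ne)) (Fin (h ν)) ℝ} {S : Params n k m} {ν : Fin p}
    (hK : IsBasisMatrix (Kb ν) (kappaSpace P W ν)) :
    StepLMI P γ W Kb S ν ↔ NegOn (stepMat P γ W S (Finset.Ici ν)) (kappaSpace P W ν) := by
  rw [← hK.negDef_he_iff, StepLMI, stepMat, Matrix.mul_add, Matrix.add_mul, Matrix.mul_sum,
    Matrix.sum_mul]

lemma stepLMI_iff_stepNeg {γ : ℝ} {W : DecVars n} {h : Fin p → ℕ}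
    {Kb : ∀ ν, Matrix (Ext n ⊕ (Fin nd ⊕ Fin ne)) (Fin (h ν)) ℝ} {S : Params n k m} {ν : Fin p}
    (hK : IsBasisMatrix (Kb ν) (kappaSpace P W ν)) :
    StepLMI P γ W Kb S ν ↔ StepNeg P γ W S ν.castSucc := by
  have htail : ∑ j ∈ Finset.Ici ν, S.term j = S.tail ν.castSucc :=
    Finset.sum_congr (by ext; simp) fun _ _ => rfl
  simp only [stepLMI_iff_negOn P hK, negOn_sum_iff, dotProduct_stepMat_mulVec, mem_kappaSpace,
    and_imp, htail, StepNeg, Fin.val_castSucc]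

end Step

/-! ### The bounded real lemma -/

section BoundedReal

variable {a b c : Type}

/-- The vector of real parts. -/
def reVec (x : a → ℂ) : a → ℝ := fun i => (x i).re

/-- The vector of imaginary parts. -/
def imVec (x : a → ℂ) : a → ℝ := fun i => (x i).im

lemma reVec_add (x y : a → ℂ) : reVec (x + y) = reVec x + reVec y := rfl

lemma imVec_add (x y : a → ℂ) : imVec (x + y) = imVec x + imVec y := rfl

lemma reVec_smul (s : ℂ) (x : a → ℂ) : reVec (s • x) = s.re • reVec x - s.im • imVec x := by
  ext i
  simp [reVec, imVec]

lemma imVec_smul (s : ℂ) (x : a → ℂ) : imVec (s • x) = s.re • imVec x + s.im • reVec x := by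
  ext i
  simp [reVec, imVec]

lemma reVec_ne_zero_or_imVec_ne_zero {x : a → ℂ} (hx : x ≠ 0) : reVec x ≠ 0 ∨ imVec x ≠ 0 := by
  by_contra! h
  exact hx (funext fun i => Complex.ext (congrFun h.1 i) (congrFun h.2 i))

variable [Fintype a] [Fintype b] [Fintype c]

lemma sum_norm_sq (x : a → ℂ) :
    ∑ i, ‖x i‖ ^ 2 = reVec x ⬝ᵥ reVec x + imVec x ⬝ᵥ imVec x := by
  simp only [dotProduct, ← Finset.sum_add_distrib, reVec, imVec, ← Complex.normSq_eq_norm_sq,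
    Complex.normSq_apply]

lemma reVec_map_mulVec {a : Type} (A : Matrix a b ℝ) (x : b → ℂ) :
    reVec (A.map (algebraMap ℝ ℂ) *ᵥ x) = A *ᵥ reVec x := by
  ext i
  simp [reVec, Matrix.mulVec, dotProduct]

lemma imVec_map_mulVec {a : Type} (A : Matrix a b ℝ) (x : b → ℂ) :
    imVec (A.map (algebraMap ℝ ℂ) *ᵥ x) = A *ᵥ imVec x := by
  ext i
  simp [imVec, Matrix.mulVec, dotProduct]

lemma dotProduct_reVec_smul_add_imVec_smul {X : Matrix a a ℝ} (hX : X.IsSymm) (s : ℂ)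
    (x : a → ℂ) :
    (X *ᵥ reVec x) ⬝ᵥ reVec (s • x) + (X *ᵥ imVec x) ⬝ᵥ imVec (s • x) =
      s.re * (reVec x ⬝ᵥ X *ᵥ reVec x + imVec x ⬝ᵥ X *ᵥ imVec x) := by
  simp only [reVec_smul, imVec_smul, dotProduct_comm (X *ᵥ _), add_dotProduct, sub_dotProduct,
    smul_dotProduct, smul_eq_mul]
  rw [dotProduct_mulVec_comm hX (imVec x) (reVec x)]
  ring

lemma hurwitz_of_lyapunov [DecidableEq a] {A X : Matrix a a ℝ} (hX : X.PosDef)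
    (h : ∀ z, z ≠ 0 → (X *ᵥ z) ⬝ᵥ A *ᵥ z < 0) : Hurwitz A := by
  intro μ hμ
  rw [spectrum.mem_iff, Matrix.isUnit_iff_isUnit_det, isUnit_iff_ne_zero, not_not] at hμ
  obtain ⟨x, hx0, hx⟩ := Matrix.exists_mulVec_eq_zero_iff.2 hμ
  have heigen : A.map (algebraMap ℝ ℂ) *ᵥ x = μ • x := by
    rw [Matrix.sub_mulVec, Algebra.algebraMap_eq_smul_one, Matrix.smul_mulVec, Matrix.one_mulVec,
      sub_eq_zero] at hx
    exact hx.symm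
  have hle : ∀ z, (X *ᵥ z) ⬝ᵥ A *ᵥ z ≤ 0 := fun z => by
    obtain rfl | hz := eq_or_ne z 0
    · simp
    · exact (h z hz).le
  have hlyap := dotProduct_reVec_smul_add_imVec_smul (posDef_iff.1 hX).1 μ x
  rw [← heigen, reVec_map_mulVec, imVec_map_mulVec] at hlyap
  have hlt : (X *ᵥ reVec x) ⬝ᵥ A *ᵥ reVec x + (X *ᵥ imVec x) ⬝ᵥ A *ᵥ imVec x < 0 := by
    rcases reVec_ne_zero_or_imVec_ne_zero hx0 with h0 | h0
    · exact add_neg_of_neg_of_nonpos (h _ h0) (hle _)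
    · exact add_neg_of_nonpos_of_neg (hle _) (h _ h0)
  rw [hlyap] at hlt
  exact neg_of_mul_neg_left hlt
    (add_nonneg (dotProduct_mulVec_nonneg hX _) (dotProduct_mulVec_nonneg hX _))

lemma exists_smaller_gain {A X : Matrix a a ℝ} {B : Matrix a b ℝ} {C : Matrix c a ℝ}
    {D : Matrix c b ℝ} {γ : ℝ} (hγ : 0 < γ)
    (h : ∀ z d e, z ≠ 0 ∨ d ≠ 0 ∨ e ≠ 0 → dissForm A B C D γ (X *ᵥ z) z d e < 0) :
    ∃ γ' ∈ Set.Ioo 0 γ, ∀ z d e, dissForm A B C D γ' (X *ᵥ z) z d e ≤ 0 := by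
  classical
  have hform : ∀ γ' z d e,
      Sum.elim z (Sum.elim d e) ⬝ᵥ dissMat A B C D γ' X 1 *ᵥ Sum.elim z (Sum.elim d e) =
        dissForm A B C D γ' (X *ᵥ z) z d e := fun γ' z d e => by
    rw [dotProduct_dissMat_mulVec, Matrix.one_mulVec]
  have hneg : NegOn (dissMat A B C D γ X 1) ⊤ := negOn_sum_iff.2 fun z d e h0 _ =>
    (hform γ z d e).trans_lt (h z d e h0)
  have hcont : ContinuousAt (fun γ' => dissMat A B C D γ' X 1) γ :=
    continuousAt_dissMat continuousAt_id continuousAt_const continuousAt_const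
  have hev := (NegOn.eventually (f := fun γ' => dissMat A B C D γ' X 1) hneg
    hcont).filter_mono (nhdsWithin_le_nhds (s := Set.Iio γ))
  obtain ⟨γ', hγ', hmem⟩ := (hev.and (Ioo_mem_nhdsLT hγ)).exists
  refine ⟨γ', hmem, fun z d e => ?_⟩
  rw [← hform]
  obtain h0 | h0 := eq_or_ne (Sum.elim z (Sum.elim d e)) 0
  · simp [h0]
  · exact (hγ' _ Submodule.mem_top h0).le

lemma dissForm_inv_smul_output {A : Matrix a a ℝ} {B : Matrix a b ℝ} {C : Matrix c a ℝ}
    {D : Matrix c b ℝ} {γ : ℝ} (hγ : γ ≠ 0) (q x : a → ℝ) (d : b → ℝ) :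
    dissForm A B C D γ q x d (γ⁻¹ • (C *ᵥ x + D *ᵥ d)) =
      q ⬝ᵥ (A *ᵥ x + B *ᵥ d) +
        (2 * γ)⁻¹ * ((C *ᵥ x + D *ᵥ d) ⬝ᵥ (C *ᵥ x + D *ᵥ d) - γ ^ 2 * (d ⬝ᵥ d)) := by
  simp only [dissForm, smul_dotProduct, dotProduct_smul, smul_eq_mul]
  field_simp
  ring

lemma sum_norm_sq_output_le {A X : Matrix a a ℝ} {B : Matrix a b ℝ} {C : Matrix c a ℝ}
    {D : Matrix c b ℝ} {γ : ℝ} (hγ : 0 < γ) (hX : X.PosDef)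
    (h : ∀ z d e, dissForm A B C D γ (X *ᵥ z) z d e ≤ 0) {s : ℂ} (hs : 0 ≤ s.re) {x : a → ℂ}
    {d : b → ℂ}
    (hx : s • x = A.map (algebraMap ℝ ℂ) *ᵥ x + B.map (algebraMap ℝ ℂ) *ᵥ d) :
    ∑ i, ‖(C.map (algebraMap ℝ ℂ) *ᵥ x + D.map (algebraMap ℝ ℂ) *ᵥ d) i‖ ^ 2 ≤
      γ ^ 2 * ∑ i, ‖d i‖ ^ 2 := by
  have hlyap := dotProduct_reVec_smul_add_imVec_smul (posDef_iff.1 hX).1 s x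
  have hstore : 0 ≤ s.re * (reVec x ⬝ᵥ X *ᵥ reVec x + imVec x ⬝ᵥ X *ᵥ imVec x) :=
    mul_nonneg hs (add_nonneg (dotProduct_mulVec_nonneg hX _) (dotProduct_mulVec_nonneg hX _))
  have hre := h (reVec x) (reVec d) (γ⁻¹ • (C *ᵥ reVec x + D *ᵥ reVec d))
  have him := h (imVec x) (imVec d) (γ⁻¹ • (C *ᵥ imVec x + D *ᵥ imVec d))
  rw [dissForm_inv_smul_output hγ.ne'] at hre him
  simp only [sum_norm_sq, hx, reVec_add, imVec_add, reVec_map_mulVec, imVec_map_mulVec]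
    at hlyap ⊢
  rw [← sub_nonpos]
  refine nonpos_of_mul_nonpos_right (a := (2 * γ)⁻¹) ?_ (by positivity)
  linarith

lemma exists_state_of_hurwitz [DecidableEq a] {A : Matrix a a ℝ} (hA : Hurwitz A) {s : ℂ}
    (hs : 0 < s.re) {c : Type} (B : Matrix a b ℝ) (C : Matrix c a ℝ) (D : Matrix c b ℝ)
    (d : b → ℂ) :
    ∃ x : a → ℂ, s • x = A.map (algebraMap ℝ ℂ) *ᵥ x + B.map (algebraMap ℝ ℂ) *ᵥ d ∧
      transferAt A B C D s *ᵥ d =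
        C.map (algebraMap ℝ ℂ) *ᵥ x + D.map (algebraMap ℝ ℂ) *ᵥ d := by
  have hunit : IsUnit (Matrix.scalar a s - A.map (algebraMap ℝ ℂ)).det := by
    rw [← Matrix.isUnit_iff_isUnit_det]
    by_contra hsing
    exact (hA s (spectrum.mem_iff.2 hsing)).not_gt hs
  refine ⟨(Matrix.scalar a s - A.map (algebraMap ℝ ℂ))⁻¹ *ᵥ (B.map (algebraMap ℝ ℂ) *ᵥ d), ?_, ?_⟩
  · set x := (Matrix.scalar a s - A.map (algebraMap ℝ ℂ))⁻¹ *ᵥ (B.map (algebraMap ℝ ℂ) *ᵥ d)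
    have hx : (Matrix.scalar a s - A.map (algebraMap ℝ ℂ)) *ᵥ x = B.map (algebraMap ℝ ℂ) *ᵥ d := by
      rw [Matrix.mulVec_mulVec, Matrix.mul_nonsing_inv _ hunit, Matrix.one_mulVec]
    rw [← hx, Matrix.sub_mulVec, add_sub_cancel, Matrix.scalar_apply,
      ← Matrix.smul_one_eq_diagonal, Matrix.smul_mulVec, Matrix.one_mulVec]
  · rw [transferAt, Matrix.add_mulVec, ← Matrix.mulVec_mulVec, ← Matrix.mulVec_mulVec]

lemma specNorm_le [DecidableEq b] {M : Matrix c b ℂ} {γ : ℝ} (hγ : 0 ≤ γ)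
    (h : ∀ d : b → ℂ, ∑ i, ‖(M *ᵥ d) i‖ ^ 2 ≤ γ ^ 2 * ∑ i, ‖d i‖ ^ 2) : specNorm M ≤ γ := by
  refine ContinuousLinearMap.opNorm_le_bound _ hγ fun d => ?_
  rw [EuclideanSpace.norm_eq, EuclideanSpace.norm_eq, ← Real.sqrt_sq hγ,
    ← Real.sqrt_mul (sq_nonneg γ)]
  exact Real.sqrt_le_sqrt (h d.ofLp)

end BoundedReal

section Controllers

variable {p : ℕ} {n k m : Fin p → ℕ} {nd ne : ℕ} {κ : Fin p → Type}
  [∀ i, Fintype (κ i)] [∀ i, DecidableEq (κ i)] {P : Plant n k m nd ne}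

lemma BoundedRealLMI.isSymm {K : Controller κ k m} {γ : ℝ}
    {𝒳 : Matrix (Idx n ⊕ Blk κ) (Idx n ⊕ Blk κ) ℝ} (h : BoundedRealLMI P K γ 𝒳) : 𝒳.IsSymm :=
  (posDef_iff.1 h.1).1

lemma BoundedRealLMI.solvesHinf {K : Controller κ k m} {γ : ℝ} (hγ : 0 < γ)
    {𝒳 : Matrix (Idx n ⊕ Blk κ) (Idx n ⊕ Blk κ) ℝ} (h : BoundedRealLMI P K γ 𝒳) :
    SolvesHinf P K γ := by
  obtain ⟨hX, hneg⟩ := boundedRealLMI_iff.1 h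
  have hA : Hurwitz (clA P K) := hurwitz_of_lyapunov hX fun z hz => by
    simpa [dissForm] using hneg z 0 0 (Or.inl hz)
  obtain ⟨γ', ⟨hγ'0, hγ'⟩, hle⟩ := exists_smaller_gain hγ hneg
  refine ⟨hA, lt_of_le_of_lt (iSup₂_le fun s hs => ENNReal.ofReal_le_ofReal ?_)
    ((ENNReal.ofReal_lt_ofReal_iff hγ).2 hγ')⟩
  refine specNorm_le hγ'0.le fun d => ?_
  obtain ⟨x, hx, hout⟩ := exists_state_of_hurwitz hA hs (clB P K) (clC P K) (clD P K) d
  rw [hout]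
  exact sum_norm_sq_output_le hγ'0 hX hle hs.le hx

lemma transferFun_submatrix_equiv {x x' i o : Type} [Fintype x] [DecidableEq x] [Fintype x']
    [DecidableEq x'] (f : x' ≃ x) (A : Matrix x x ℝ) (B : Matrix x i ℝ) (C : Matrix o x ℝ)
    (D : Matrix o i ℝ) :
    transferFun (A.submatrix f f) (B.submatrix f id) (C.submatrix id f) D =
      transferFun A B C D := by
  have hres : Matrix.scalar x' (RatFunc.X : RatFunc ℝ) -
        (A.submatrix f f).map (algebraMap ℝ (RatFunc ℝ)) =
      (Matrix.scalar x RatFunc.X - A.map (algebraMap ℝ (RatFunc ℝ))).submatrix f f := by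
    simp [Matrix.submatrix_sub, Matrix.submatrix_map, Matrix.scalar_apply]
  rw [transferFun, transferFun, hres, Matrix.inv_submatrix_equiv, ← Matrix.submatrix_map,
    ← Matrix.submatrix_map, Matrix.submatrix_mul_equiv, Matrix.submatrix_mul_equiv,
    Matrix.submatrix_id_id]

lemma mcMillanDegree_le {x i o : Type} [Fintype x] [DecidableEq x]
    (A : Matrix x x ℝ) (B : Matrix x i ℝ) (C : Matrix o x ℝ) (D : Matrix o i ℝ) :
    mcMillanDegree A B C D ≤ Fintype.card x :=
  Nat.sInf_le ⟨_, _, _, D, transferFun_submatrix_equiv (Fintype.equivFin x).symm A B C D⟩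

/-- The controller with relabeled states. -/
def Controller.reindex {κ κ' : Fin p → Type} (f : ∀ i, κ' i ≃ κ i) (K : Controller κ k m) :
    Controller κ' k m where
  A := K.A.submatrix (Equiv.sigmaCongrRight f) (Equiv.sigmaCongrRight f)
  B := K.B.submatrix (Equiv.sigmaCongrRight f) id
  C := K.C.submatrix id (Equiv.sigmaCongrRight f)
  D := K.D

lemma Controller.IsStructured.reindex {κ κ' : Fin p → Type} (f : ∀ i, κ' i ≃ κ i)
    {K : Controller κ k m} (hK : K.IsStructured) : (K.reindex f).IsStructured :=
  ⟨fun _ _ h => hK.1 _ _ h, fun _ _ h => hK.2.1 _ _ h, fun _ _ h => hK.2.2.1 _ _ h, hK.2.2.2⟩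

lemma dissForm_closedLoop_reindex {κ' : Fin p → Type} [∀ i, Fintype (κ' i)]
    [∀ i, DecidableEq (κ' i)] (f : ∀ i, κ' i ≃ κ i) (K : Controller κ k m) (γ : ℝ)
    (q z : Idx n ⊕ Blk κ → ℝ) (d : Fin nd → ℝ) (e : Fin ne → ℝ) :
    dissForm (clA P (K.reindex f)) (clB P (K.reindex f)) (clC P (K.reindex f))
        (clD P (K.reindex f)) γ (q ∘ Sum.map id (Equiv.sigmaCongrRight f))
        (z ∘ Sum.map id (Equiv.sigmaCongrRight f)) d e =
      dissForm (clA P K) (clB P K) (clC P K) (clD P K) γ q z d e := by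
  have hmat : (K.reindex f).mat = K.mat.submatrix
      (Equiv.sumCongr (Equiv.refl _) (Equiv.sigmaCongrRight f))
      (Equiv.sumCongr (Equiv.refl _) (Equiv.sigmaCongrRight f)) := by
    ext (i | i) (j | j) <;> rfl
  have helim : ∀ {t : Type} (u : t → ℝ) (v : Blk κ → ℝ),
      Sum.elim u (v ∘ Equiv.sigmaCongrRight f) =
        Sum.elim u v ∘ Equiv.sumCongr (Equiv.refl _) (Equiv.sigmaCongrRight f) := fun u v => by
    ext (i | i) <;> rfl
  rw [← Sum.elim_comp_inl_inr q, ← Sum.elim_comp_inl_inr z, Sum.elim_comp_map, Sum.elim_comp_map,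
    Function.comp_id, Function.comp_id, dissForm_closedLoop, dissForm_closedLoop, ctrlForm,
    ctrlForm, hmat, helim, helim, Matrix.submatrix_mulVec_equiv, Function.comp_assoc,
    Equiv.self_comp_symm, Function.comp_id, comp_equiv_dotProduct_comp_equiv]

lemma BoundedRealLMI.reindex {κ' : Fin p → Type} [∀ i, Fintype (κ' i)] [∀ i, DecidableEq (κ' i)]
    (f : ∀ i, κ' i ≃ κ i) {K : Controller κ k m} {γ : ℝ}
    {𝒳 : Matrix (Idx n ⊕ Blk κ) (Idx n ⊕ Blk κ) ℝ} (h : BoundedRealLMI P K γ 𝒳) :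
    ∃ 𝒳', BoundedRealLMI P (K.reindex f) γ 𝒳' := by
  let F := Equiv.sumCongr (Equiv.refl (Idx n)) (Equiv.sigmaCongrRight f)
  refine ⟨𝒳.submatrix F F,
    boundedRealLMI_iff.2 ⟨h.1.submatrix F.injective, fun z d e h0 => ?_⟩⟩
  obtain ⟨z, rfl⟩ : ∃ y, z = y ∘ F := ⟨z ∘ F.symm, by simp [Function.comp_assoc]⟩
  have hz : z ∘ F ≠ 0 → z ≠ 0 := fun hF hz => hF (by rw [hz]; rfl)
  rw [Matrix.submatrix_mulVec_equiv, Function.comp_assoc, Equiv.self_comp_symm, Function.comp_id]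
  exact (dissForm_closedLoop_reindex f K γ _ z d e).trans_lt
    ((boundedRealLMI_iff.1 h).2 z d e (h0.imp_left hz))

end Controllers

/-! ### Quadratic forms of coupled matrices -/

section Coupling

variable {a : Type} [Fintype a]

lemma dotProduct_fromBlocks_coupling_mulVec {Q Q' X Y X' Y' : Matrix a a ℝ} (hQ : Q.IsSymm)
    (hX : X = Q * Y) (hX' : X' = Q' * Y') (v w : a → ℝ) :
    Sum.elim v w ⬝ᵥ Matrix.fromBlocks (Yᵀ * X) (Xᵀ * Y') (Y'ᵀ * X) (Y'ᵀ * X') *ᵥ Sum.elim v w =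
      (Y *ᵥ v + Y' *ᵥ w) ⬝ᵥ Q *ᵥ (Y *ᵥ v + Y' *ᵥ w) + (Y' *ᵥ w) ⬝ᵥ (Q' - Q) *ᵥ (Y' *ᵥ w) := by
  subst hX hX'
  rw [Matrix.fromBlocks_mulVec, Sum.elim_comp_inl, Sum.elim_comp_inr, sumElim_dotProduct_sumElim]
  simp only [← Matrix.mulVec_mulVec, dotProduct_add, Matrix.dotProduct_transpose_mulVec,
    Matrix.mulVec_add, Matrix.sub_mulVec, add_dotProduct, dotProduct_sub]
  rw [dotProduct_mulVec_comm hQ (Y *ᵥ v) (Y' *ᵥ w), dotProduct_comm (Q *ᵥ Y *ᵥ v) (Y *ᵥ v),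
    dotProduct_comm (Q *ᵥ Y *ᵥ v) (Y' *ᵥ w), dotProduct_comm (Q' *ᵥ Y' *ᵥ w)]
  ring

lemma eq_add_sum_sub {G : Type*} [AddCommGroup G] {p : ℕ} (Q : Fin (p + 1) → G)
    (i : Fin (p + 1)) :
    Q i = Q 0 + ∑ k : Fin p with k.succ ≤ i, (Q k.succ - Q k.castSucc) := by
  induction i using Fin.induction with
  | zero => simp
  | succ i ih =>
    have hfilter : Finset.univ.filter (fun k : Fin p => k.succ ≤ i.succ) =
        insert i (Finset.univ.filter fun k : Fin p => k.succ ≤ i.castSucc) := by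
      ext k
      simp only [Finset.mem_filter, Finset.mem_univ, true_and, Finset.mem_insert, Fin.ext_iff,
        Fin.le_def, Fin.val_succ, Fin.val_castSucc]
      omega
    rw [hfilter, Finset.sum_insert (by simp), add_left_comm, ← ih, sub_add_cancel]

lemma sum_sum_dotProduct_mulVec {ι : Type*} (s : Finset ι) (M : Matrix a a ℝ) (y : ι → a → ℝ) :
    ∑ i ∈ s, ∑ j ∈ s, y i ⬝ᵥ M *ᵥ y j = (∑ i ∈ s, y i) ⬝ᵥ M *ᵥ ∑ i ∈ s, y i := by
  simp only [Matrix.mulVec_sum, dotProduct_sum, sum_dotProduct]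
  exact Finset.sum_comm

lemma sum_sum_dotProduct_min_mulVec {p : ℕ} (Q : Fin (p + 1) → Matrix a a ℝ)
    (y : Fin (p + 1) → a → ℝ) :
    ∑ i, ∑ j, y i ⬝ᵥ Q (min i j) *ᵥ y j = (∑ i, y i) ⬝ᵥ Q 0 *ᵥ ∑ i, y i +
      ∑ k : Fin p, (∑ i with k.succ ≤ i, y i) ⬝ᵥ (Q k.succ - Q k.castSucc) *ᵥ
        ∑ i with k.succ ≤ i, y i := by
  have hmin : ∀ i j, y i ⬝ᵥ Q (min i j) *ᵥ y j = y i ⬝ᵥ Q 0 *ᵥ y j +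
      ∑ k : Fin p, if k.succ ≤ i then if k.succ ≤ j then
        y i ⬝ᵥ (Q k.succ - Q k.castSucc) *ᵥ y j else 0 else 0 := fun i j => by
    rw [eq_add_sum_sub Q (min i j), Matrix.add_mulVec, dotProduct_add, Matrix.sum_mulVec,
      dotProduct_sum, Finset.sum_filter]
    simp only [le_min_iff, ite_and]
  simp only [hmin, Finset.sum_add_distrib, ← sum_sum_dotProduct_mulVec, Finset.sum_filter,
    Finset.sum_comm (t := (Finset.univ : Finset (Fin p)))]
  congr 1
  refine Finset.sum_congr rfl fun k _ => Finset.sum_congr rfl fun i _ =>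
    Finset.sum_congr rfl fun j _ => ?_
  by_cases hi : k.succ ≤ i <;> by_cases hj : k.succ ≤ j <;> simp [hi, hj]

lemma exists_sum_tail_ne_zero {ι G : Type*} [LinearOrder ι] [Fintype ι] [AddCommMonoid G]
    {y : ι → G} (hy : y ≠ 0) : ∃ i, ∑ j with i ≤ j, y j ≠ 0 := by
  classical
  obtain ⟨i₀, hi₀⟩ := Function.ne_iff.1 hy
  obtain ⟨i, hi⟩ := (Finset.univ.filter fun i => y i ≠ 0).exists_maximal ⟨i₀, by simpa using hi₀⟩
  refine ⟨i, ?_⟩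
  rw [Finset.sum_eq_single_of_mem i (by simp) fun j hj hne => ?_]
  · simpa using hi.1
  · by_contra h0
    exact hne (hi.eq_of_le (by simpa using h0) (by simpa using hj)).symm

lemma sum_sum_dotProduct_min_mulVec_pos {p : ℕ} {Q : Fin (p + 1) → Matrix a a ℝ}
    (h0 : (Q 0).PosDef) (hQ : ∀ j : Fin p, (Q j.succ - Q j.castSucc).PosDef)
    {y : Fin (p + 1) → a → ℝ} (hy : y ≠ 0) :
    0 < ∑ i, ∑ j, y i ⬝ᵥ Q (min i j) *ᵥ y j := by
  obtain ⟨i, hi⟩ := exists_sum_tail_ne_zero hy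
  rw [sum_sum_dotProduct_min_mulVec]
  have hnonneg : ∀ k : Fin p, 0 ≤ (∑ i with k.succ ≤ i, y i) ⬝ᵥ
      (Q k.succ - Q k.castSucc) *ᵥ ∑ i with k.succ ≤ i, y i := fun k =>
    dotProduct_mulVec_nonneg (hQ k) _
  cases i using Fin.cases with
  | zero =>
    simp only [Fin.zero_le, Finset.filter_true] at hi
    exact add_pos_of_pos_of_nonneg ((posDef_iff.1 h0).2 _ hi)
      (Finset.sum_nonneg fun k _ => hnonneg k)
  | succ k =>
    exact add_pos_of_nonneg_of_pos (dotProduct_mulVec_nonneg h0 _)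
      (Finset.sum_pos' (fun k _ => hnonneg k)
        ⟨k, Finset.mem_univ k, (posDef_iff.1 (hQ k)).2 _ hi⟩)

lemma exists_posDef_factor {b : Type} [Fintype b] {Y Z : Matrix a b ℝ}
    (hc : Fintype.card a = Fintype.card b) (h : (Yᵀ * Z).PosDef) :
    ∃ X : Matrix a a ℝ, X.PosDef ∧ ∀ z, ∃ w, z = Y *ᵥ w ∧ X *ᵥ z = Z *ᵥ w := by
  classical
  obtain ⟨R, hYR⟩ : ∃ R : Matrix b a ℝ, Y * R = 1 := by
    have hL : (Yᵀ * Z)⁻¹ᵀ * Zᵀ * Y = 1 := by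
      have hinv := Matrix.mul_nonsing_inv _ ((Matrix.isUnit_iff_isUnit_det _).1 h.isUnit)
      have := congrArg Matrix.transpose hinv
      rwa [Matrix.transpose_mul, Matrix.transpose_mul, Matrix.transpose_transpose,
        Matrix.transpose_one, ← Matrix.mul_assoc] at this
    exact ⟨_, (Matrix.mul_eq_one_comm_of_equiv (Fintype.equivOfCardEq hc)).2 hL⟩
  have hX : Z * R = Rᴴ * (Yᵀ * Z) * R := by
    rw [Matrix.conjTranspose_eq_transpose_of_trivial, ← Matrix.mul_assoc Rᵀ,
      ← Matrix.transpose_mul, hYR, Matrix.transpose_one, Matrix.one_mul]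
  have hR : ∀ z, Y *ᵥ (R *ᵥ z) = z := fun z => by
    rw [Matrix.mulVec_mulVec, hYR, Matrix.one_mulVec]
  refine ⟨Z * R, ?_, fun z => ⟨R *ᵥ z, (hR z).symm, (Matrix.mulVec_mulVec _ _ _).symm⟩⟩
  rw [hX]
  exact h.conjTranspose_mul_mul_same (Function.LeftInverse.injective hR)

end Coupling

namespace DecVars

variable {p : ℕ} {n : Fin p → ℕ} {W : DecVars n}

lemma Y_mulVec_lo (W : DecVars n) (j : Fin (p + 1)) (v : Idx n → ℝ) {b : Idx n}
    (hb : b.1.val < j.val) : (W.Y j *ᵥ v) b = v b := by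
  rw [Y, Matrix.reindex_apply, Matrix.submatrix_mulVec_equiv, Function.comp_apply,
    Equiv.sumCompl_symm_apply_of_pos (p := fun a : Idx n => a.1.val < j.val) hb,
    Matrix.fromBlocks_mulVec, Sum.elim_inl,
    Matrix.one_mulVec, Matrix.zero_mulVec, add_zero]
  rfl

lemma X_mulVec_hi (W : DecVars n) (j : Fin (p + 1)) (v : Idx n → ℝ) {b : Idx n}
    (hb : ¬ b.1.val < j.val) : (W.X j *ᵥ v) b = v b := by
  rw [X, Matrix.reindex_apply, Matrix.submatrix_mulVec_equiv, Function.comp_apply,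
    Equiv.sumCompl_symm_apply_of_neg (p := fun a : Idx n => a.1.val < j.val) hb,
    Matrix.fromBlocks_mulVec, Sum.elim_inr,
    Matrix.one_mulVec, Matrix.zero_mulVec, zero_add]
  rfl

/-- The coupling inequalities. -/
def Coupled (W : DecVars n) : Prop :=
  ∀ j : Fin p, (Matrix.fromBlocks
      ((W.Y j.castSucc)ᵀ * W.X j.castSucc) ((W.X j.castSucc)ᵀ * W.Y j.succ)
      ((W.Y j.succ)ᵀ * W.X j.castSucc)     ((W.Y j.succ)ᵀ * W.X j.succ)).PosDef

/-- The matrix `X_j Y_j⁻¹`; the coupling inequalities say that these matrices are positive definite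
and strictly increasing in `j`. -/
def Q (W : DecVars n) (j : Fin (p + 1)) : Matrix (Idx n) (Idx n) ℝ := W.X j * (W.Y j)⁻¹

lemma Coupled.posDef_YX (hW : W.Coupled) (j : Fin (p + 1)) : ((W.Y j)ᵀ * W.X j).PosDef := by
  cases p with
  | zero =>
    have : IsEmpty (Idx n) := ⟨fun i => i.1.elim0⟩
    exact posDef_iff.2 ⟨Subsingleton.elim _ _, fun x hx => absurd (Subsingleton.elim x 0) hx⟩
  | succ p =>
    cases j using Fin.lastCases with
    | last => exact (hW (Fin.last p)).submatrix (e := Sum.inr) Sum.inr_injective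
    | cast i => exact (hW i).submatrix (e := Sum.inl) Sum.inl_injective

lemma Coupled.isUnit_det_Y (hW : W.Coupled) (j : Fin (p + 1)) : IsUnit (W.Y j).det := by
  have h := (Matrix.isUnit_iff_isUnit_det _).1 (hW.posDef_YX j).isUnit
  rw [Matrix.det_mul, Matrix.det_transpose] at h
  exact isUnit_of_mul_isUnit_left h

lemma Coupled.Y_mulVec_inv_mulVec (hW : W.Coupled) (j : Fin (p + 1)) (z : Idx n → ℝ) :
    W.Y j *ᵥ ((W.Y j)⁻¹ *ᵥ z) = z := by
  rw [Matrix.mulVec_mulVec, Matrix.mul_nonsing_inv _ (hW.isUnit_det_Y j), Matrix.one_mulVec]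

lemma Coupled.X_eq (hW : W.Coupled) (j : Fin (p + 1)) : W.X j = W.Q j * W.Y j := by
  rw [Q, Matrix.mul_assoc, Matrix.nonsing_inv_mul _ (hW.isUnit_det_Y j), Matrix.mul_one]

lemma Coupled.posDef_Q (hW : W.Coupled) (j : Fin (p + 1)) : (W.Q j).PosDef := by
  have h : W.Q j = ((W.Y j)⁻¹)ᴴ * ((W.Y j)ᵀ * W.X j) * (W.Y j)⁻¹ := by
    rw [Matrix.conjTranspose_eq_transpose_of_trivial, ← Matrix.mul_assoc, ← Matrix.transpose_mul,
      Matrix.mul_nonsing_inv _ (hW.isUnit_det_Y j), Matrix.transpose_one, Matrix.one_mul, Q]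
  rw [h]
  exact (hW.posDef_YX j).conjTranspose_mul_mul_same
    (Function.LeftInverse.injective (hW.Y_mulVec_inv_mulVec j))

lemma Coupled.isSymm_Q (hW : W.Coupled) (j : Fin (p + 1)) : (W.Q j).IsSymm :=
  (posDef_iff.1 (hW.posDef_Q j)).1

lemma Coupled.posDef_sub (hW : W.Coupled) (j : Fin p) :
    (W.Q j.succ - W.Q j.castSucc).PosDef := by
  refine posDef_iff.2 ⟨(hW.isSymm_Q _).sub (hW.isSymm_Q _), fun y hy => ?_⟩
  have hne : Sum.elim ((W.Y j.castSucc)⁻¹ *ᵥ (-y)) ((W.Y j.succ)⁻¹ *ᵥ y) ≠ 0 :=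
    sumElim_ne_zero_iff.2 <| Or.inr fun h0 => hy <| by
      rw [← hW.Y_mulVec_inv_mulVec j.succ y, h0, Matrix.mulVec_zero]
  have h := (posDef_iff.1 (hW j)).2 _ hne
  rwa [dotProduct_fromBlocks_coupling_mulVec (hW.isSymm_Q _) (hW.X_eq _) (hW.X_eq _),
    hW.Y_mulVec_inv_mulVec, hW.Y_mulVec_inv_mulVec, neg_add_cancel, zero_dotProduct,
    zero_add] at h

end DecVars

/-! ### Sufficiency: the certificate and the controller -/

section Rows

variable {p : ℕ} {n : Fin p → ℕ} {W : DecVars n}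

/-- The `j`-th block of a vector with `p + 1` blocks. -/
def blk (w : Ext n → ℝ) (j : Fin (p + 1)) : Idx n → ℝ := fun i => w (j, i)

lemma exists_blk_ne_zero {w : Ext n → ℝ} (hw : w ≠ 0) : ∃ j, blk w j ≠ 0 := by
  by_contra! h
  exact hw (funext fun i => congrFun (h i.1) i.2)

lemma rowX_mulVec (W : DecVars n) (w : Ext n → ℝ) : rowX W *ᵥ w = ∑ j, W.X j *ᵥ blk w j := by
  ext a
  simp [rowX, Matrix.mulVec, dotProduct, Fintype.sum_prod_type, blk]

lemma rowY_mulVec (W : DecVars n) (w : Ext n → ℝ) : rowY W *ᵥ w = ∑ j, W.Y j *ᵥ blk w j := by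
  ext a
  simp [rowY, Matrix.mulVec, dotProduct, Fintype.sum_prod_type, blk]

lemma rowU_mulVec (w : Ext n → ℝ) (j : Fin p) (i : Idx n) :
    (rowU n *ᵥ w) ⟨j, i⟩ = blk w j.succ i := by
  have hrow : rowU n ⟨j, i⟩ = Pi.single (j.succ, i) 1 := by
    ext b
    simp [rowU, Pi.single_apply, Prod.ext_iff]
  rw [Matrix.mulVec, hrow, single_dotProduct, one_mul, blk]

lemma rowV_mulVec (hW : W.Coupled) (w : Ext n → ℝ) (j : Fin p) (i : Idx n) :
    (rowV W *ᵥ w) ⟨j, i⟩ =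
      ((W.Y j.succ)ᵀ *ᵥ ∑ l with l < j.succ, (W.Q l - W.Q j.succ) *ᵥ W.Y l *ᵥ blk w l) i := by
  have hblock : ∀ l, (W.Y j.succ)ᵀ *ᵥ (W.Q l - W.Q j.succ) *ᵥ W.Y l *ᵥ blk w l =
      ((W.Y j.succ)ᵀ * W.X l - (W.X j.succ)ᵀ * W.Y l) *ᵥ blk w l := fun l => by
    rw [hW.X_eq l, hW.X_eq j.succ, Matrix.transpose_mul, (hW.isSymm_Q _).eq, Matrix.mul_assoc,
      ← Matrix.mul_sub, ← Matrix.sub_mul, ← Matrix.mulVec_mulVec, ← Matrix.mulVec_mulVec]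
  rw [Matrix.mulVec_sum, Finset.sum_congr rfl fun l _ => hblock l, Finset.sum_apply,
    Finset.sum_filter, Matrix.mulVec, dotProduct, Fintype.sum_prod_type]
  refine Finset.sum_congr rfl fun l _ => ?_
  by_cases hl : l < j.succ
  · simp [rowV, Fin.le_castSucc_iff, hl, blk, Matrix.mulVec, dotProduct]
  · simp [rowV, Fin.le_castSucc_iff, hl]

-- `rowV W` is block triangular and has invertible diagonal blocks.
lemma blk_eq_zero_of_rowV_mulVec (hW : W.Coupled) {w : Ext n → ℝ} {ν : Fin (p + 1)}
    (h : ∀ b : Blk (KBlk n), b.1.val < ν.val → (rowV W *ᵥ w) b = 0) (j : Fin (p + 1))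
    (hj : j < ν) : blk w j = 0 := by
  induction j using WellFoundedLT.induction with
  | ind j ih =>
  obtain ⟨i, rfl⟩ := Fin.exists_castSucc_eq.2 (Fin.ne_last_of_lt hj)
  have hdiag : (W.Y i.succ)ᵀ *ᵥ (W.Q i.castSucc - W.Q i.succ) *ᵥ
      W.Y i.castSucc *ᵥ blk w i.castSucc = 0 := by
    ext l
    have hl := h ⟨i, l⟩ hj
    rwa [rowV_mulVec hW, Finset.sum_eq_single_of_mem i.castSucc (by simp) fun l hl hne => by
      have hlt := lt_of_le_of_ne (Fin.le_castSucc_iff.2 (by simpa using hl)) hne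
      rw [ih l hlt (hlt.trans hj), Matrix.mulVec_zero, Matrix.mulVec_zero]] at hl
  have hsub := Matrix.eq_zero_of_mulVec_eq_zero
    (by rw [Matrix.det_transpose]; exact (hW.isUnit_det_Y _).ne_zero) hdiag
  refine Matrix.eq_zero_of_mulVec_eq_zero (hW.isUnit_det_Y i.castSucc).ne_zero ?_
  by_contra h0
  have hpos := (posDef_iff.1 (hW.posDef_sub i)).2 _ h0
  rw [← neg_sub, Matrix.neg_mulVec, hsub, neg_zero, dotProduct_zero] at hpos
  exact lt_irrefl _ hpos

lemma rowY_mulVec_dotProduct_rowX_mulVec (hW : W.Coupled) (w w' : Ext n → ℝ) :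
    (rowY W *ᵥ w) ⬝ᵥ (rowX W *ᵥ w') =
      ∑ j, ∑ i, (W.Y i *ᵥ blk w i) ⬝ᵥ W.Q j *ᵥ W.Y j *ᵥ blk w' j := by
  simp only [rowY_mulVec, rowX_mulVec, dotProduct_sum, sum_dotProduct, hW.X_eq,
    ← Matrix.mulVec_mulVec]

lemma rowV_mulVec_dotProduct_rowU_mulVec (hW : W.Coupled) (w w' : Ext n → ℝ) :
    (rowV W *ᵥ w) ⬝ᵥ (rowU n *ᵥ w') =
      ∑ j, ∑ i with i < j, (W.Y i *ᵥ blk w i) ⬝ᵥ (W.Q i - W.Q j) *ᵥ W.Y j *ᵥ blk w' j := by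
  rw [Fin.sum_univ_succ, Finset.filter_false_of_mem fun i _ => Fin.not_lt_zero i,
    Finset.sum_empty, zero_add, dotProduct, Fintype.sum_sigma]
  refine Finset.sum_congr rfl fun j _ => ?_
  simp only [rowV_mulVec hW, rowU_mulVec]
  rw [← dotProduct, dotProduct_comm, Matrix.dotProduct_transpose_mulVec, sum_dotProduct]
  refine Finset.sum_congr rfl fun i _ => ?_
  rw [dotProduct_comm, dotProduct_mulVec_comm ((hW.isSymm_Q _).sub (hW.isSymm_Q _))]

lemma dotProduct_rows_mulVec (hW : W.Coupled) (w w' : Ext n → ℝ) :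
    w ⬝ᵥ ((Matrix.fromRows (rowY W) (rowV W))ᵀ * Matrix.fromRows (rowX W) (rowU n)) *ᵥ w' =
      ∑ i, ∑ j, (W.Y i *ᵥ blk w i) ⬝ᵥ W.Q (min i j) *ᵥ W.Y j *ᵥ blk w' j := by
  rw [← Matrix.mulVec_mulVec, Matrix.dotProduct_transpose_mulVec, dotProduct_comm,
    Matrix.fromRows_mulVec, Matrix.fromRows_mulVec, sumElim_dotProduct_sumElim,
    rowY_mulVec_dotProduct_rowX_mulVec hW, rowV_mulVec_dotProduct_rowU_mulVec hW,
    ← Finset.sum_add_distrib, Finset.sum_comm (s := Finset.univ) (t := Finset.univ)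
      (f := fun i j => (W.Y i *ᵥ blk w i) ⬝ᵥ W.Q (min i j) *ᵥ W.Y j *ᵥ blk w' j)]
  refine Finset.sum_congr rfl fun j _ => ?_
  rw [Finset.sum_filter, ← Finset.sum_add_distrib]
  refine Finset.sum_congr rfl fun i _ => ?_
  split_ifs with hij
  · rw [min_eq_left hij.le, Matrix.sub_mulVec, dotProduct_sub, add_sub_cancel]
  · rw [min_eq_right (not_lt.1 hij), add_zero]

lemma posDef_rows (hW : W.Coupled) :
    ((Matrix.fromRows (rowY W) (rowV W))ᵀ * Matrix.fromRows (rowX W) (rowU n)).PosDef := by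
  refine posDef_iff.2 ⟨isSymm_of_dotProduct_mulVec_comm fun w w' => ?_, fun w hw => ?_⟩
  · rw [dotProduct_rows_mulVec hW, dotProduct_rows_mulVec hW, Finset.sum_comm]
    refine Finset.sum_congr rfl fun i _ => Finset.sum_congr rfl fun j _ => ?_
    rw [min_comm, dotProduct_mulVec_comm (hW.isSymm_Q _)]
  · rw [dotProduct_rows_mulVec hW]
    obtain ⟨j, hj⟩ := exists_blk_ne_zero hw
    refine sum_sum_dotProduct_min_mulVec_pos (y := fun i => W.Y i *ᵥ blk w i) (hW.posDef_Q 0)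
      hW.posDef_sub fun h0 => hj ?_
    exact Matrix.eq_zero_of_mulVec_eq_zero (hW.isUnit_det_Y j).ne_zero (congrFun h0 j)

end Rows

section BlockTriangular

variable {p : ℕ} {κ κ' : Fin p → Type} {M : Matrix (Blk κ) (Blk κ') ℝ}

lemma LowerTri.mulVec_congr [∀ i, Fintype (κ' i)] (hM : LowerTri M)
    {j : Fin (p + 1)} {x y : Blk κ' → ℝ} (h : ∀ b, b.1.val < j.val → x b = y b) {a : Blk κ}
    (ha : a.1.val < j.val) : (M *ᵥ x) a = (M *ᵥ y) a := by
  simp only [Matrix.mulVec, dotProduct]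
  refine Finset.sum_congr rfl fun b _ => ?_
  by_cases hb : b.1.val < j.val
  · rw [h b hb]
  · rw [hM a b (Fin.lt_def.2 (by omega)), zero_mul, zero_mul]

lemma LowerTri.transpose_mulVec_congr [∀ i, Fintype (κ i)] (hM : LowerTri M)
    {j : Fin (p + 1)} {x y : Blk κ → ℝ} (h : ∀ a, ¬ a.1.val < j.val → x a = y a) {b : Blk κ'}
    (hb : ¬ b.1.val < j.val) : (Mᵀ *ᵥ x) b = (Mᵀ *ᵥ y) b := by
  simp only [Matrix.mulVec, dotProduct, Matrix.transpose_apply]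
  refine Finset.sum_congr rfl fun a _ => ?_
  by_cases ha : a.1.val < j.val
  · rw [hM a b (Fin.lt_def.2 (by omega)), zero_mul, zero_mul]
  · rw [h a ha]

variable [∀ i, Fintype (κ i)] [∀ i, Fintype (κ' i)]

lemma LowerTri.dotProduct_mulVec_eq_zero (hM : LowerTri M) {j : Fin (p + 1)} {x : Blk κ → ℝ}
    {y : Blk κ' → ℝ} (hx : ∀ a, ¬ a.1.val < j.val → x a = 0)
    (hy : ∀ b, b.1.val < j.val → y b = 0) : x ⬝ᵥ M *ᵥ y = 0 := by
  refine Finset.sum_eq_zero fun a _ => ?_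
  by_cases ha : a.1.val < j.val
  · rw [hM.mulVec_congr (y := 0) hy ha, Matrix.mulVec_zero, Pi.zero_apply, mul_zero]
  · rw [hx a ha, zero_mul]

lemma lowerTri_selL_mul_mul_selR [∀ i, DecidableEq (κ i)] [∀ i, DecidableEq (κ' i)] (j : Fin p)
    (M : Matrix (Hi κ j.castSucc) (κ' j) ℝ) :
    LowerTri (selL κ j.castSucc * M * (selR κ' j)ᵀ) := by
  intro a b hab
  rw [Matrix.mul_assoc, Matrix.mul_apply]
  refine Finset.sum_eq_zero fun l _ => ?_
  by_cases hal : a = l.1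
  · have hjb : ∀ i, (⟨j, i⟩ : Blk κ') ≠ b := by
      rintro i rfl
      exact l.2 (hal ▸ hab)
    simp [Matrix.mul_apply, selR, hjb]
  · simp [selL, hal]

lemma ctrlForm_eq_zero {n k m : Fin p → ℕ} {nd ne : ℕ} {P : Plant n k m nd ne}
    {K : Controller κ k m} (hK : K.IsStructured) {j : Fin (p + 1)} {q x : Idx n → ℝ}
    {σ ξ : Blk κ → ℝ} {d : Fin nd → ℝ} {e : Fin ne → ℝ}
    (hy : ∀ a : Idx k, a.1.val < j.val → measOut P x d a = 0)
    (hu : ∀ b : Idx m, ¬ b.1.val < j.val → coInput P q e b = 0)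
    (hξ : ∀ a : Blk κ, a.1.val < j.val → ξ a = 0)
    (hσ : ∀ b : Blk κ, ¬ b.1.val < j.val → σ b = 0) : ctrlForm P K.mat q x σ ξ d e = 0 := by
  obtain ⟨hA, hB, hC, hD⟩ := hK
  rw [ctrlForm, Controller.mat, Matrix.fromBlocks_mulVec, sumElim_dotProduct_sumElim,
    Sum.elim_comp_inl, Sum.elim_comp_inr, dotProduct_add, dotProduct_add,
    hA.dotProduct_mulVec_eq_zero hσ hξ, hB.dotProduct_mulVec_eq_zero hσ hy,
    hC.dotProduct_mulVec_eq_zero hu hξ, hD.dotProduct_mulVec_eq_zero hu hy]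
  norm_num

end BlockTriangular

section Construction

variable {p : ℕ} {n k m : Fin p → ℕ} {nd ne : ℕ} {P : Plant n k m nd ne} {γ : ℝ} {W : DecVars n}

lemma measOut_Y_mulVec (hC : LowerTri P.C) {j : Fin (p + 1)} {v : Idx n → ℝ} {d : Fin nd → ℝ}
    {a : Idx k} (ha : a.1.val < j.val) : measOut P (W.Y j *ᵥ v) d a = measOut P v d a :=
  congrArg (· + (P.F *ᵥ d) a) (hC.mulVec_congr (fun _ hb => W.Y_mulVec_lo j v hb) ha)

lemma coInput_X_mulVec (hB : LowerTri P.B) {j : Fin (p + 1)} {v : Idx n → ℝ} {e : Fin ne → ℝ}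
    {b : Idx m} (hb : ¬ b.1.val < j.val) : coInput P (W.X j *ᵥ v) e b = coInput P v e b :=
  congrArg (· + (P.Eᵀ *ᵥ e) b) (hB.transpose_mulVec_congr (fun _ hc => W.X_mulVec_hi j v hc) hb)

lemma ProjNeg.plantForm_rows_neg (hP : P.IsStructured) {ν : Fin (p + 1)}
    (hν : ProjNeg P γ (W.X ν) (W.Y ν) ν) {w : Ext n → ℝ} {d : Fin nd → ℝ} {e : Fin ne → ℝ}
    (h0 : w ≠ 0 ∨ d ≠ 0 ∨ e ≠ 0) (hw : ∀ j, j ≠ ν → blk w j = 0)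
    (hy : ∀ a : Idx k, a.1.val < ν.val → measOut P (rowY W *ᵥ w) d a = 0)
    (hu : ∀ b : Idx m, ¬ b.1.val < ν.val → coInput P (rowX W *ᵥ w) e b = 0) :
    plantForm P γ (rowX W *ᵥ w) (rowY W *ᵥ w) d e < 0 := by
  have hX : rowX W *ᵥ w = W.X ν *ᵥ blk w ν := by
    rw [rowX_mulVec, Fintype.sum_eq_single ν fun j hj => by rw [hw j hj, Matrix.mulVec_zero]]
  have hY : rowY W *ᵥ w = W.Y ν *ᵥ blk w ν := by
    rw [rowY_mulVec, Fintype.sum_eq_single ν fun j hj => by rw [hw j hj, Matrix.mulVec_zero]]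
  rw [hX] at hu ⊢
  rw [hY] at hy ⊢
  refine hν (blk w ν) d e (h0.imp_left fun h => ?_)
    (fun a ha => measOut_Y_mulVec hP.2.2 ha ▸ hy a ha)
    (fun b hb => coInput_X_mulVec hP.2.1 hb ▸ hu b hb)
  obtain ⟨j, hj⟩ := exists_blk_ne_zero h
  rwa [← not_imp_comm.1 (hw j) hj]

lemma stepNeg_last (hP : P.IsStructured) (hW : W.Coupled)
    (hproj : ProjNeg P γ (W.X (Fin.last p)) (W.Y (Fin.last p)) (Fin.last p))
    (S : Params n k m) : StepNeg P γ W S (Fin.last p) := by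
  intro w d e h0 hy hV
  have htail : S.tail (Fin.last p) = 0 := by
    rw [Params.tail, Finset.filter_false_of_mem, Finset.sum_empty]
    exact fun j _ => not_le.2 (Fin.castSucc_lt_last j)
  rw [htail, ctrlForm, Matrix.zero_mulVec, dotProduct_zero, add_zero]
  exact hproj.plantForm_rows_neg hP h0
    (fun j hj => blk_eq_zero_of_rowV_mulVec hW hV j (Fin.lt_last_iff_ne_last.2 hj)) hy
    fun b hb => absurd b.1.2 hb

lemma eq_zero_of_val_lt_succ {κ : Fin p → Type} {f : Blk κ → ℝ} {ν : Fin p}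
    (hlt : ∀ a, a.1.val < ν.val → f a = 0) (heq : ∀ i, f ⟨ν, i⟩ = 0) (a : Blk κ)
    (ha : a.1.val < ν.succ.val) : f a = 0 := by
  obtain ⟨i, a⟩ := a
  rcases Nat.lt_succ_iff_lt_or_eq.1 ha with hi | hi
  · exact hlt _ hi
  · obtain rfl : i = ν := Fin.ext hi
    exact heq a

lemma StepNeg.negOn_inf_ker_stepN {S : Params n k m} {ν : Fin p}
    (hS : StepNeg P γ W S ν.succ) :
    NegOn (stepMat P γ W S (Finset.Ioi ν)) (kappaSpace P W ν ⊓ ker (stepN P W ν)) := by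
  refine negOn_sum_iff.2 fun w d e h0 ⟨hκ, hN⟩ => ?_
  obtain ⟨hy, hV⟩ := (mem_kappaSpace P).1 hκ
  rw [SetLike.mem_coe, ker, LinearMap.mem_ker, Matrix.mulVecLin_apply, stepN_mulVec,
    ← Sum.elim_zero_zero, Sum.elim_eq_iff] at hN
  have htail : ∑ j ∈ Finset.Ioi ν, S.term j = S.tail ν.succ :=
    Finset.sum_congr (by ext; simp [Fin.succ_le_castSucc_iff]) fun _ _ => rfl
  rw [dotProduct_stepMat_mulVec, htail]
  exact hS w d e h0 (eq_zero_of_val_lt_succ hy (congrFun hN.1))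
    (eq_zero_of_val_lt_succ hV (congrFun hN.2))

lemma Params.isStructured_ofMat_sum_term (S : Params n k m) (s : Finset (Fin p)) :
    (Controller.ofMat (∑ j ∈ s, S.term j)).IsStructured := by
  have hterm : ∀ j, (Controller.ofMat (S.term j)).IsStructured := fun j => by
    rw [Params.term, ← Matrix.fromBlocks_toBlocks (S j), Matrix.fromBlocks_multiply,
      Matrix.fromBlocks_multiply]
    simp only [Matrix.zero_mul, Matrix.mul_zero, add_zero, zero_add]
    exact ⟨lowerTri_selL_mul_mul_selR j _, lowerTri_selL_mul_mul_selR j _,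
      lowerTri_selL_mul_mul_selR j _, lowerTri_selL_mul_mul_selR j _⟩
  refine ⟨?_, ?_, ?_, ?_⟩ <;> intro a b hab <;>
    refine (Matrix.sum_apply _ _ _ _).trans (Finset.sum_eq_zero fun j _ => ?_)
  exacts [(hterm j).1 a b hab, (hterm j).2.1 a b hab, (hterm j).2.2.1 a b hab,
    (hterm j).2.2.2 a b hab]

-- The controller drops out here, and what remains is the projected inequality with index `ν`.
lemma negOn_inf_ker_stepM_transpose (hP : P.IsStructured) (hW : W.Coupled) {ν : Fin p}
    (hproj : ProjNeg P γ (W.X ν.castSucc) (W.Y ν.castSucc) ν.castSucc) (S : Params n k m)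
    (s : Finset (Fin p)) :
    NegOn (stepMat P γ W S s) (kappaSpace P W ν ⊓ ker (stepM P W ν)ᵀ) := by
  refine negOn_sum_iff.2 fun w d e h0 ⟨hκ, hM⟩ => ?_
  obtain ⟨hy, hV⟩ := (mem_kappaSpace P).1 hκ
  rw [SetLike.mem_coe, ker, LinearMap.mem_ker, Matrix.mulVecLin_apply, stepM_transpose_mulVec,
    ← Sum.elim_zero_zero, Sum.elim_eq_iff] at hM
  have hu : ∀ b : Idx m, ¬ b.1.val < ν.val → coInput P (rowX W *ᵥ w) e b = 0 :=
    fun b hb => congrFun hM.1 ⟨b, hb⟩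
  have hU : ∀ b : Blk (KBlk n), ¬ b.1.val < ν.val → (rowU n *ᵥ w) b = 0 :=
    fun b hb => congrFun hM.2 ⟨b, hb⟩
  have hw : ∀ j, j ≠ ν.castSucc → blk w j = 0 := fun j hj => by
    rcases lt_or_gt_of_ne hj with hj | hj
    · exact blk_eq_zero_of_rowV_mulVec hW (ν := ν.castSucc) hV j hj
    · obtain ⟨i, rfl⟩ := Fin.exists_succ_eq.2 (Fin.ne_zero_of_lt hj)
      ext l
      rw [← rowU_mulVec]
      exact hU ⟨i, l⟩ (not_lt.2 (Fin.castSucc_lt_succ_iff.1 hj))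
  have hctrl := ctrlForm_eq_zero (P := P) (j := ν.castSucc) (S.isStructured_ofMat_sum_term s)
    hy hu hV hU
  rw [Controller.mat, Controller.ofMat, Matrix.fromBlocks_toBlocks] at hctrl
  rw [dotProduct_stepMat_mulVec, hctrl, add_zero]
  exact hproj.plantForm_rows_neg hP h0 hw hy hu

lemma stepMat_update (S : Params n k m) (ν : Fin p) (T) :
    stepMat P γ W (Function.update S ν T) (Finset.Ici ν) =
      stepMat P γ W S (Finset.Ioi ν) + stepM P W ν * T * stepN P W ν := by
  rw [stepMat, stepMat, ← Finset.Ioi_insert, Finset.sum_insert (by simp), Function.update_self,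
    Finset.sum_congr rfl fun j hj => by rw [Function.update_of_ne (Finset.mem_Ioi.1 hj).ne']]
  abel

lemma exists_stepLMI (hP : P.IsStructured) (hW : W.Coupled)
    (hproj : ∀ j, ProjNeg P γ (W.X j) (W.Y j) j) {h : Fin p → ℕ}
    {Kb : ∀ ν, Matrix (Ext n ⊕ (Fin nd ⊕ Fin ne)) (Fin (h ν)) ℝ} {ν : Fin p}
    (hK : IsBasisMatrix (Kb ν) (kappaSpace P W ν)) {S : Params n k m}
    (hS : StepNeg P γ W S ν.succ) : ∃ T, StepLMI P γ W Kb (Function.update S ν T) ν := by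
  obtain ⟨T, hT⟩ := exists_negOn_add_mul_mul hS.negOn_inf_ker_stepN
    (negOn_inf_ker_stepM_transpose hP hW (hproj _) S _)
  exact ⟨T, (stepLMI_iff_negOn P hK).2 (stepMat_update S ν T ▸ hT)⟩

lemma exists_stepNeg (hP : P.IsStructured) (hW : W.Coupled)
    (hproj : ∀ j, ProjNeg P γ (W.X j) (W.Y j) j) (ν : Fin (p + 1)) :
    ∃ S : Params n k m, StepNeg P γ W S ν := by
  induction ν using Fin.reverseInduction with
  | last => exact ⟨0, stepNeg_last hP hW (hproj _) 0⟩
  | cast ν ih =>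
    obtain ⟨S, hS⟩ := ih
    choose h Kb hKb using fun ν => exists_isBasisMatrix (kappaSpace P W ν)
    obtain ⟨T, hT⟩ := exists_stepLMI hP hW hproj (hKb ν) hS
    exact ⟨_, (stepLMI_iff_stepNeg P (hKb ν)).1 hT⟩

lemma stepNeg_of_stepLMI (hP : P.IsStructured) (hW : W.Coupled)
    (hproj : ProjNeg P γ (W.X (Fin.last p)) (W.Y (Fin.last p)) (Fin.last p)) {h : Fin p → ℕ}
    {Kb : ∀ ν, Matrix (Ext n ⊕ (Fin nd ⊕ Fin ne)) (Fin (h ν)) ℝ}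
    (hK : ∀ ν, IsBasisMatrix (Kb ν) (kappaSpace P W ν)) {S : Params n k m} (ν : Fin (p + 1))
    (hS : ∀ μ : Fin p, ν ≤ μ.castSucc → StepLMI P γ W Kb S μ) : StepNeg P γ W S ν := by
  induction ν using Fin.lastCases with
  | last => exact stepNeg_last hP hW hproj S
  | cast ν => exact (stepLMI_iff_stepNeg P (hK ν)).1 (hS ν le_rfl)

lemma StepNeg.exists_boundedRealLMI (hW : W.Coupled) {S : Params n k m}
    (hS : StepNeg P γ W S 0) : ∃ 𝒳, BoundedRealLMI P S.controller γ 𝒳 := by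
  obtain ⟨𝒳, hX, hw⟩ := exists_posDef_factor (by simp; ring) (posDef_rows hW)
  refine ⟨𝒳, boundedRealLMI_iff.2 ⟨hX, fun z d e h0 => ?_⟩⟩
  obtain ⟨w, hz, hXz⟩ := hw z
  rw [hXz, hz, Matrix.fromRows_mulVec, Matrix.fromRows_mulVec, dissForm_closedLoop,
    Params.mat_controller]
  refine hS w d e (h0.imp_left ?_) (fun a ha => absurd ha (Nat.not_lt_zero _))
    (fun a ha => absurd ha (Nat.not_lt_zero _))
  rintro hz0 rfl
  exact hz0 (by rw [hz, Matrix.mulVec_zero])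

lemma Params.controller_isStructured (S : Params n k m) : S.controller.IsStructured :=
  S.isStructured_ofMat_sum_term Finset.univ

lemma Params.controller_degree_le (S : Params n k m) : S.controller.degree ≤ (∑ i, n i) * p :=
  (mcMillanDegree_le _ _ _ _).trans (by simp [mul_comm])

end Construction

/-! ### Necessity of the synthesis inequalities -/

section SchurComplement

variable {a b : Type} [Fintype a] [Fintype b]

lemma exists_linearMap_mulVec_eq_zero_on {X : Matrix a a ℝ} (hX : X.PosDef) (s : Set a) :
    ∃ T : (a → ℝ) →ₗ[ℝ] (a → ℝ), ∀ z, (∀ i ∉ s, T z i = z i) ∧ ∀ i ∈ s, (X *ᵥ T z) i = 0 := by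
  classical
  obtain ⟨hs, hpos⟩ := posDef_iff.1 hX
  have hform : ∀ u v, Matrix.toLinearMap₂' ℝ X u v = u ⬝ᵥ X *ᵥ v :=
    fun u v => Matrix.toLinearMap₂'_apply' X u v
  have hsymm : LinearMap.BilinForm.IsSymm (Matrix.toLinearMap₂' ℝ X) :=
    ⟨fun u v => by rw [hform, hform, dotProduct_mulVec_comm hs]⟩
  obtain ⟨π, hπ, horth⟩ := exists_orthogonal_projection hsymm
    (U := Submodule.pi sᶜ fun _ => ⊥) fun u _ h0 => by
      by_contra hu
      exact (hpos u hu).ne' (by rwa [hform] at h0)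
  refine ⟨(LinearMap.id - π : (a → ℝ) →ₗ[ℝ] a → ℝ), fun z => ⟨fun i hi => ?_, fun i hi => ?_⟩⟩
  · have hzero : π z i = 0 := hπ.map_mem z i hi
    rw [LinearMap.sub_apply, LinearMap.id_apply, Pi.sub_apply, hzero, sub_zero]
  · have hmem : Pi.single i 1 ∈ Submodule.pi sᶜ fun _ : a => (⊥ : Submodule ℝ ℝ) :=
      fun l hl => Pi.single_eq_of_ne (ne_of_mem_of_not_mem hi hl).symm _
    have hker : π ((LinearMap.id - π : (a → ℝ) →ₗ[ℝ] a → ℝ) z) = 0 := by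
      rw [LinearMap.sub_apply, LinearMap.id_apply, map_sub, hπ.map_id _ (hπ.map_mem z), sub_self]
    have := horth _ hmem _ hker
    rwa [hform, single_dotProduct, one_mul] at this

/-- `Q` is the Schur complement of `X` that results from eliminating the coordinates in `s`, with
the remaining ones in `b` set to zero. -/
def IsSchur (X : Matrix (a ⊕ b) (a ⊕ b) ℝ) (s : Set b) (Q : Matrix a a ℝ) : Prop :=
  ∀ x, ∃ ξ σ, X *ᵥ Sum.elim x ξ = Sum.elim (Q *ᵥ x) σ ∧ (∀ i ∉ s, ξ i = 0) ∧ ∀ i ∈ s, σ i = 0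

lemma exists_isSchur {X : Matrix (a ⊕ b) (a ⊕ b) ℝ} (hX : X.PosDef) (s : Set b) :
    ∃ Q, IsSchur X s Q := by
  classical
  obtain ⟨T, hT⟩ := exists_linearMap_mulVec_eq_zero_on hX (Sum.inr '' s)
  let Q : Matrix a a ℝ := LinearMap.toMatrix' <| LinearMap.funLeft ℝ ℝ Sum.inl ∘ₗ
    X.mulVecLin ∘ₗ T ∘ₗ (Matrix.fromRows 1 0 : Matrix (a ⊕ b) a ℝ).mulVecLin
  have hQ : ∀ x, Q *ᵥ x = (X *ᵥ T (Sum.elim x 0)) ∘ Sum.inl := fun x => by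
    simp only [Q, LinearMap.toMatrix'_mulVec, LinearMap.comp_apply, Matrix.mulVecLin_apply,
      Matrix.fromRows_mulVec, Matrix.one_mulVec, Matrix.zero_mulVec]
    rfl
  refine ⟨Q, fun x => ⟨T (Sum.elim x 0) ∘ Sum.inr, (X *ᵥ T (Sum.elim x 0)) ∘ Sum.inr, ?_,
    fun i hi => (hT _).1 _ (by simpa using hi), fun i hi => (hT _).2 _ ⟨i, hi, rfl⟩⟩⟩
  have hx : Sum.elim x (T (Sum.elim x 0) ∘ Sum.inr) = T (Sum.elim x 0) := by
    ext (i | i)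
    · exact ((hT (Sum.elim x 0)).1 (Sum.inl i) (by simp)).symm
    · rfl
  rw [hx, hQ, Sum.elim_comp_inl_inr]

variable {X : Matrix (a ⊕ b) (a ⊕ b) ℝ} {s : Set b} {Q : Matrix a a ℝ}

lemma sumElim_dotProduct_mulVec_sumElim {x y : a → ℝ} {ξ η τ : b → ℝ}
    (hX : X *ᵥ Sum.elim y η = Sum.elim (Q *ᵥ y) τ) (hξ : ∀ i ∉ s, ξ i = 0)
    (hτ : ∀ i ∈ s, τ i = 0) : Sum.elim x ξ ⬝ᵥ X *ᵥ Sum.elim y η = x ⬝ᵥ Q *ᵥ y := by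
  rw [hX, sumElim_dotProduct_sumElim, add_eq_left]
  refine Finset.sum_eq_zero fun i _ => ?_
  by_cases hi : i ∈ s
  · rw [hτ i hi, mul_zero]
  · rw [hξ i hi, zero_mul]

lemma IsSchur.posDef (hQ : IsSchur X s Q) (hX : X.PosDef) : Q.PosDef := by
  obtain ⟨hs, hpos⟩ := posDef_iff.1 hX
  refine posDef_iff.2 ⟨isSymm_of_dotProduct_mulVec_comm fun x y => ?_, fun x hx => ?_⟩
  · obtain ⟨ξ, σ, hx, hξ, hσ⟩ := hQ x
    obtain ⟨η, τ, hy, hη, hτ⟩ := hQ y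
    rw [← sumElim_dotProduct_mulVec_sumElim hy hξ hτ, ← sumElim_dotProduct_mulVec_sumElim hx hη hσ,
      dotProduct_mulVec_comm hs]
  · obtain ⟨ξ, σ, hz, hξ, hσ⟩ := hQ x
    rw [← sumElim_dotProduct_mulVec_sumElim hz hξ hσ]
    exact hpos _ (sumElim_ne_zero_iff.2 (Or.inl hx))

lemma IsSchur.posSemidef_sub {s' : Set b} {Q' : Matrix a a ℝ} (hQ : IsSchur X s Q)
    (hQ' : IsSchur X s' Q') (hX : X.PosDef) (hss : s' ⊆ s) : (Q' - Q).PosSemidef := by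
  have hs := (posDef_iff.1 hX).1
  refine Matrix.PosSemidef.of_dotProduct_mulVec_nonneg
    ((hQ'.posDef hX).isHermitian.sub (hQ.posDef hX).isHermitian) fun x => ?_
  obtain ⟨ξ, σ, hx, hξ, hσ⟩ := hQ x
  obtain ⟨η, τ, hx', hη, hτ⟩ := hQ' x
  have hη' : ∀ i ∉ s, η i = 0 := fun i hi => hη i fun h => hi (hss h)
  have hdiff := dotProduct_mulVec_nonneg hX (Sum.elim x η - Sum.elim x ξ)
  rw [Matrix.mulVec_sub, sub_dotProduct, dotProduct_sub, dotProduct_sub,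
    dotProduct_mulVec_comm hs (Sum.elim x ξ) (Sum.elim x η),
    sumElim_dotProduct_mulVec_sumElim hx hξ hσ, sumElim_dotProduct_mulVec_sumElim hx hη' hσ,
    sumElim_dotProduct_mulVec_sumElim hx' hη hτ, sub_self, sub_zero] at hdiff
  rwa [star_trivial, Matrix.sub_mulVec, dotProduct_sub]

end SchurComplement

namespace DecVars

variable {p : ℕ} {n : Fin p → ℕ} {W : DecVars n} {Q : Fin (p + 1) → Matrix (Idx n) (Idx n) ℝ}

/-- The partition of `M` into blocks `1, …, j - 1` and `j, …, p`. -/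
def split (M : Matrix (Idx n) (Idx n) ℝ) (j : Fin (p + 1)) :
    Matrix (Lo (fun i => Fin (n i)) j ⊕ Hi (fun i => Fin (n i)) j)
      (Lo (fun i => Fin (n i)) j ⊕ Hi (fun i => Fin (n i)) j) ℝ :=
  (Matrix.reindex (Equiv.sumCompl fun a : Idx n => a.1.val < j.val)
    (Equiv.sumCompl fun a : Idx n => a.1.val < j.val)).symm M

/-- The decision variables with `X_j = Q_j Y_j`, for positive definite matrices `Q_j`. -/
def ofQ (Q : Fin (p + 1) → Matrix (Idx n) (Idx n) ℝ) : DecVars n where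
  Xh j := (split (Q j) j).toBlocks₁₁ -
    (split (Q j) j).toBlocks₁₂ * (split (Q j) j).toBlocks₂₂⁻¹ * (split (Q j) j).toBlocks₂₁
  Yh j := (split (Q j) j).toBlocks₂₂⁻¹
  Zh j := (split (Q j) j).toBlocks₂₂⁻¹ * (split (Q j) j).toBlocks₂₁

lemma isUnit_det_split {M : Matrix (Idx n) (Idx n) ℝ} (hM : M.PosDef) (j : Fin (p + 1)) :
    IsUnit (split M j).toBlocks₂₂.det :=
  (Matrix.isUnit_iff_isUnit_det _).1 (hM.submatrix Subtype.val_injective).isUnit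

lemma isSymm_split {M : Matrix (Idx n) (Idx n) ℝ} (hM : M.PosDef) (j : Fin (p + 1)) :
    (split M j).toBlocks₁₁ᵀ = (split M j).toBlocks₁₁ ∧
      (split M j).toBlocks₁₂ᵀ = (split M j).toBlocks₂₁ ∧
      (split M j).toBlocks₂₁ᵀ = (split M j).toBlocks₁₂ ∧
      (split M j).toBlocks₂₂⁻¹ᵀ = (split M j).toBlocks₂₂⁻¹ := by
  have hs : (split M j).IsSymm := (posDef_iff.1 hM).1.submatrix _
  rw [← Matrix.fromBlocks_toBlocks (split M j), Matrix.isSymm_fromBlocks_iff] at hs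
  exact ⟨hs.1, hs.2.1, hs.2.2.1, by rw [Matrix.transpose_nonsing_inv, hs.2.2.2]⟩

lemma ofQ_isSymm (hQ : ∀ j, (Q j).PosDef) (j : Fin (p + 1)) :
    ((ofQ Q).Xh j).IsSymm ∧ ((ofQ Q).Yh j).IsSymm := by
  obtain ⟨h₁₁, h₁₂, h₂₁, h₂₂⟩ := isSymm_split (hQ j) j
  refine ⟨?_, h₂₂⟩
  simp only [ofQ, Matrix.IsSymm, Matrix.transpose_sub, Matrix.transpose_mul, h₁₁, h₁₂, h₂₁, h₂₂,
    Matrix.mul_assoc]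

lemma ofQ_X_eq {j : Fin (p + 1)} (hQ : (Q j).PosDef) : (ofQ Q).X j = Q j * (ofQ Q).Y j := by
  obtain ⟨-, -, h₂₁, h₂₂⟩ := isSymm_split hQ j
  have hinv := Matrix.mul_nonsing_inv _ (isUnit_det_split hQ j)
  have hblocks := Equiv.apply_symm_apply (Matrix.reindex
    (Equiv.sumCompl fun a : Idx n => a.1.val < j.val)
    (Equiv.sumCompl fun a : Idx n => a.1.val < j.val)) (Q j)
  rw [← split, ← Matrix.fromBlocks_toBlocks (split (Q j) j)] at hblocks
  conv_rhs => rw [← hblocks]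
  rw [X, Y, Matrix.reindex_apply, Matrix.reindex_apply, Matrix.reindex_apply,
    Matrix.submatrix_mul_equiv, Matrix.fromBlocks_multiply]
  simp only [ofQ, Matrix.transpose_mul, h₂₁, h₂₂, Matrix.mul_one, Matrix.mul_zero, zero_add,
    Matrix.mul_neg, ← sub_eq_add_neg, ← Matrix.mul_assoc, hinv, Matrix.one_mul, sub_self]

lemma continuous_ofQ_Y {T : Type*} [TopologicalSpace T]
    {Q : T → Fin (p + 1) → Matrix (Idx n) (Idx n) ℝ} {j : Fin (p + 1)}
    (hc : Continuous fun t => Q t j) (hQ : ∀ t, (Q t j).PosDef) :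
    Continuous fun t => (ofQ (Q t)).Y j := by
  have hsplit : Continuous fun t => split (Q t j) j := hc.matrix_submatrix _ _
  have h₂₁ : Continuous fun t => (split (Q t j) j).toBlocks₂₁ := hsplit.matrix_submatrix _ _
  have h₂₂ : Continuous fun t => (split (Q t j) j).toBlocks₂₂ := hsplit.matrix_submatrix _ _
  have hinv : Continuous fun t => (split (Q t j) j).toBlocks₂₂⁻¹ := by
    refine continuous_iff_continuousAt.2 fun t =>
      ContinuousAt.comp (g := Inv.inv) (continuousAt_matrix_inv _ ?_) h₂₂.continuousAt
    rw [Ring.inverse_eq_inv']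
    exact continuousAt_inv₀ (isUnit_det_split (hQ t) j).ne_zero
  exact (continuous_const.matrix_fromBlocks continuous_const (hinv.matrix_mul h₂₁).neg
    hinv).matrix_reindex _ _

lemma Y_mulVec_ne_zero {M : Matrix (Idx n) (Idx n) ℝ} {j : Fin (p + 1)}
    (hX : W.X j = M * W.Y j) {v : Idx n → ℝ} (hv : v ≠ 0) : W.Y j *ᵥ v ≠ 0 := by
  intro h0
  refine hv (funext fun b => ?_)
  by_cases hb : b.1.val < j.val
  · rw [← W.Y_mulVec_lo j v hb, h0]
  · rw [← W.X_mulVec_hi j v hb, hX, ← Matrix.mulVec_mulVec, h0, Matrix.mulVec_zero]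

lemma coupled_of_X_eq (hQ : ∀ j, (Q j).PosDef)
    (hd : ∀ j : Fin p, (Q j.succ - Q j.castSucc).PosDef) (hX : ∀ j, W.X j = Q j * W.Y j) :
    W.Coupled := by
  intro j
  have hs : ∀ j, (Q j).IsSymm := fun j => (posDef_iff.1 (hQ j)).1
  have hYX : ∀ i, ((W.Y i)ᵀ * W.X i).IsSymm := fun i => by
    rw [hX i, Matrix.IsSymm, Matrix.transpose_mul, Matrix.transpose_mul, (hs i).eq,
      Matrix.transpose_transpose, Matrix.mul_assoc]
  refine posDef_iff.2 ⟨Matrix.IsSymm.fromBlocks (hYX _) ?_ (hYX _), fun z hz => ?_⟩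
  · rw [Matrix.transpose_mul, Matrix.transpose_transpose]
  · obtain ⟨v, w, rfl⟩ : ∃ v w, z = Sum.elim v w := ⟨_, _, (Sum.elim_comp_inl_inr z).symm⟩
    rw [dotProduct_fromBlocks_coupling_mulVec (hs _) (hX _) (hX _)]
    by_cases hw : w = 0
    · have hv : v ≠ 0 := (sumElim_ne_zero_iff.1 hz).resolve_right (not_not.2 hw)
      rw [hw, Matrix.mulVec_zero, add_zero, zero_dotProduct, add_zero]
      exact (posDef_iff.1 (hQ _)).2 _ (Y_mulVec_ne_zero (hX _) hv)
    · exact add_pos_of_nonneg_of_pos (dotProduct_mulVec_nonneg (hQ _) _)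
        ((posDef_iff.1 (hd j)).2 _ (Y_mulVec_ne_zero (hX _) hw))

end DecVars

section Necessity

open scoped NNReal

variable {p : ℕ} {n k m : Fin p → ℕ} {nd ne : ℕ} {P : Plant n k m nd ne} {γ : ℝ}
  {κ : Fin p → Type} [∀ i, Fintype (κ i)] [∀ i, DecidableEq (κ i)] {K : Controller κ k m}

/-- The projected inequality with index `j` in terms of the state `x` and the costate `M x`. -/
def SchurNeg (P : Plant n k m nd ne) (γ : ℝ) (M : Matrix (Idx n) (Idx n) ℝ) (j : Fin (p + 1)) :
    Prop :=
  ∀ x d e, x ≠ 0 ∨ d ≠ 0 ∨ e ≠ 0 →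
    (∀ a : Idx k, a.1.val < j.val → measOut P x d a = 0) →
    (∀ b : Idx m, ¬ b.1.val < j.val → coInput P (M *ᵥ x) e b = 0) →
    plantForm P γ (M *ᵥ x) x d e < 0

lemma BoundedRealLMI.schurNeg {𝒳 : Matrix (Idx n ⊕ Blk κ) (Idx n ⊕ Blk κ) ℝ}
    (h : BoundedRealLMI P K γ 𝒳) (hK : K.IsStructured) {M : Matrix (Idx n) (Idx n) ℝ}
    {j : Fin (p + 1)} (hM : IsSchur 𝒳 {b | ¬ b.1.val < j.val} M) : SchurNeg P γ M j := by
  intro x d e h0 hy hu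
  obtain ⟨ξ, σ, hz, hξ, hσ⟩ := hM x
  have hneg := (boundedRealLMI_iff.1 h).2 (Sum.elim x ξ) d e
    (h0.imp_left fun hx => sumElim_ne_zero_iff.2 (Or.inl hx))
  rwa [hz, dissForm_closedLoop, ctrlForm_eq_zero hK hy hu (fun a ha => hξ a (not_not.2 ha)) hσ,
    add_zero] at hneg

lemma SchurNeg.projNeg (hP : P.IsStructured) {M : Matrix (Idx n) (Idx n) ℝ} {j : Fin (p + 1)}
    (h : SchurNeg P γ M j) {W : DecVars n} (hX : W.X j = M * W.Y j) :
    ProjNeg P γ (W.X j) (W.Y j) j := by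
  intro v d e h0 hy hu
  have hMY : M *ᵥ (W.Y j *ᵥ v) = W.X j *ᵥ v := by rw [hX, Matrix.mulVec_mulVec]
  rw [← hMY]
  refine h _ d e (h0.imp_left (DecVars.Y_mulVec_ne_zero hX))
    (fun a ha => (measOut_Y_mulVec hP.2.2 ha).trans (hy a ha)) fun b hb => ?_
  rw [hMY, coInput_X_mulVec hP.2.1 hb, hu b hb]

lemma eventually_projNeg_ofQ (hP : P.IsStructured) {T : Type*} [TopologicalSpace T]
    {Q : T → Fin (p + 1) → Matrix (Idx n) (Idx n) ℝ} {j : Fin (p + 1)}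
    (hc : Continuous fun t => Q t j) (hQ : ∀ t, (Q t j).PosDef) {t₀ : T}
    (h : SchurNeg P γ (Q t₀ j) j) :
    ∀ᶠ t in nhds t₀, ProjNeg P γ ((DecVars.ofQ (Q t)).X j) ((DecVars.ofQ (Q t)).Y j) j := by
  have hY := DecVars.continuous_ofQ_Y hc hQ
  have hX : Continuous fun t => (DecVars.ofQ (Q t)).X j := by
    simp only [fun t => DecVars.ofQ_X_eq (hQ t)]
    exact hc.mul hY
  simpa only [projNeg_iff] using NegOn.eventually
    (f := fun t => dissMat P.A P.B₀ P.C₀ P.D₀ γ ((DecVars.ofQ (Q t)).X j) ((DecVars.ofQ (Q t)).Y j))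
    (projNeg_iff.1 (h.projNeg hP (DecVars.ofQ_X_eq (hQ t₀))))
    (continuousAt_dissMat continuousAt_const hX.continuousAt hY.continuousAt)

lemma exists_decVars_of_posSemidef_sub (hP : P.IsStructured)
    {Q : Fin (p + 1) → Matrix (Idx n) (Idx n) ℝ} (hQ : ∀ j, (Q j).PosDef)
    (hmono : ∀ j : Fin p, (Q j.succ - Q j.castSucc).PosSemidef) (hneg : ∀ j, SchurNeg P γ (Q j) j) :
    ∃ W : DecVars n, (∀ j, (W.Xh j).IsSymm ∧ (W.Yh j).IsSymm) ∧
      (∀ j, ProjNeg P γ (W.X j) (W.Y j) j) ∧ W.Coupled := by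
  let R : ℝ≥0 → Fin (p + 1) → Matrix (Idx n) (Idx n) ℝ := fun ε j => Q j + ((ε : ℝ) * j.val) • 1
  have hR : ∀ ε j, (R ε j).PosDef := fun ε j =>
    (hQ j).add_posSemidef (Matrix.PosSemidef.one.smul (by positivity))
  have hd : ∀ ε, 0 < ε → ∀ j : Fin p, (R ε j.succ - R ε j.castSucc).PosDef := fun ε hε j => by
    have hstep : R ε j.succ - R ε j.castSucc = Q j.succ - Q j.castSucc + (ε : ℝ) • 1 := by
      simp only [R, Fin.val_succ, Fin.val_castSucc, Nat.cast_succ, mul_add_one, add_smul]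
      abel
    rw [hstep]
    exact (Matrix.PosDef.one.smul (NNReal.coe_pos.2 hε)).posSemidef_add (hmono j)
  have hev : ∀ᶠ ε in nhds (0 : ℝ≥0), ∀ j,
      ProjNeg P γ ((DecVars.ofQ (R ε)).X j) ((DecVars.ofQ (R ε)).Y j) j :=
    Filter.eventually_all.2 fun j => eventually_projNeg_ofQ hP (by fun_prop) (hR · j)
      (by simpa [R] using hneg j)
  obtain ⟨ε, hproj, hε⟩ := ((hev.filter_mono nhdsWithin_le_nhds).and
    (self_mem_nhdsWithin (s := Set.Ioi (0 : ℝ≥0)))).exists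
  exact ⟨_, DecVars.ofQ_isSymm (hR ε), hproj,
    DecVars.coupled_of_X_eq (hR ε) (hd ε hε) fun j => DecVars.ofQ_X_eq (hR ε j)⟩

lemma BoundedRealLMI.exists_decVars {𝒳 : Matrix (Idx n ⊕ Blk κ) (Idx n ⊕ Blk κ) ℝ}
    (h : BoundedRealLMI P K γ 𝒳) (hP : P.IsStructured) (hK : K.IsStructured) :
    ∃ W : DecVars n, (∀ j, (W.Xh j).IsSymm ∧ (W.Yh j).IsSymm) ∧
      (∀ j, ProjNeg P γ (W.X j) (W.Y j) j) ∧ W.Coupled := by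
  choose Q hQ using fun j : Fin (p + 1) => exists_isSchur h.1 {b : Blk κ | ¬ b.1.val < j.val}
  exact exists_decVars_of_posSemidef_sub hP (fun j => (hQ j).posDef h.1)
    (fun j => (hQ _).posSemidef_sub (hQ _) h.1 fun b hb hlt => hb (hlt.trans (Nat.lt_succ_self _)))
    fun j => h.schurNeg hK (hQ j)

end Necessity

section Synthesis

variable {p : ℕ} {n k m : Fin p → ℕ} {nd ne : ℕ} {P : Plant n k m nd ne} {γ : ℝ}

lemma feasible_iff {g : Fin (p + 1) → ℕ}
    {Γ : ∀ j, Matrix (Idx n ⊕ (Fin nd ⊕ Fin ne)) (Fin (g j)) ℝ}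
    (hΓ : ∀ j, IsBasisMatrix (Γ j) (gammaSpace P j)) (W : DecVars n) :
    Feasible P γ Γ W ↔ (∀ j, (W.Xh j).IsSymm ∧ (W.Yh j).IsSymm) ∧
      (∀ j, ProjNeg P γ (W.X j) (W.Y j) j) ∧ W.Coupled :=
  and_congr_right fun _ => and_congr_left fun _ => forall_congr' fun j =>
    negDef_projected_iff (hΓ j)

lemma exists_controller (hP : P.IsStructured) {W : DecVars n} (hW : W.Coupled)
    (hproj : ∀ j, ProjNeg P γ (W.X j) (W.Y j) j) :
    ∃ (nK : Fin p → ℕ) (K : Controller (fun i => Fin (nK i)) k m),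
      K.IsStructured ∧ K.degree ≤ (∑ i, n i) * p ∧ ∃ 𝒳, BoundedRealLMI P K γ 𝒳 := by
  obtain ⟨S, hS⟩ := exists_stepNeg hP hW hproj 0
  obtain ⟨𝒳, hX⟩ := hS.exists_boundedRealLMI hW
  refine ⟨fun _ => Fintype.card (Idx n),
    S.controller.reindex fun _ => (Fintype.equivFin (Idx n)).symm,
    S.controller_isStructured.reindex _, ?_, hX.reindex _⟩
  exact (mcMillanDegree_le _ _ _ _).trans (by simp [mul_comm])

end Synthesis

end NestedHinf

end

open NestedHinf in
theorem theorem2 {p : ℕ} (n k m : Fin p → ℕ) (nd ne : ℕ)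
    (P : Plant n k m nd ne) (hP : P.IsStructured) (γ : ℝ) (hγ : 0 < γ)
    (g : Fin (p + 1) → ℕ) (Γ : ∀ j, Matrix (Idx n ⊕ (Fin nd ⊕ Fin ne)) (Fin (g j)) ℝ)
    (hΓ : ∀ j, IsBasisMatrix (Γ j) (gammaSpace P j)) :
    -- existence of a structured controller is equivalent to feasibility
    ((∃ (nK : Fin p → ℕ) (K : Controller (fun i => Fin (nK i)) k m),
        K.IsStructured ∧ ∃ 𝒳, 𝒳.IsSymm ∧ BoundedRealLMI P K γ 𝒳) ↔
      ∃ W : DecVars n, Feasible P γ Γ W) ∧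
    -- degree bound
    ((∃ W : DecVars n, Feasible P γ Γ W) →
      ∃ (nK : Fin p → ℕ) (K : Controller (fun i => Fin (nK i)) k m),
        K.IsStructured ∧ K.degree ≤ (∑ i, n i) * p ∧ SolvesHinf P K γ) ∧
    -- recursive construction from any feasible point
    (∀ W : DecVars n, Feasible P γ Γ W →
      ∀ (h : Fin p → ℕ) (Kb : ∀ ν, Matrix (Ext n ⊕ (Fin nd ⊕ Fin ne)) (Fin (h ν)) ℝ),
        (∀ ν, IsBasisMatrix (Kb ν) (kappaSpace P W ν)) →
        (∀ (ν : Fin p) (S : Params n k m), (∀ μ, ν < μ → StepLMI P γ W Kb S μ) →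
          ∃ T, StepLMI P γ W Kb (Function.update S ν T) ν) ∧
        (∀ S : Params n k m, (∀ ν, StepLMI P γ W Kb S ν) →
          S.controller.IsStructured ∧ S.controller.degree ≤ (∑ i, n i) * p ∧
          (∃ 𝒳, 𝒳.IsSymm ∧ BoundedRealLMI P S.controller γ 𝒳) ∧
          SolvesHinf P S.controller γ)) := by
  refine ⟨⟨?_, ?_⟩, ?_, fun W hW h Kb hKb => ?_⟩
  · rintro ⟨nK, K, hK, 𝒳, -, hX⟩
    obtain ⟨W, hW⟩ := hX.exists_decVars hP hK
    exact ⟨W, (feasible_iff hΓ W).2 hW⟩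
  · rintro ⟨W, hW⟩
    obtain ⟨-, hproj, hc⟩ := (feasible_iff hΓ W).1 hW
    obtain ⟨nK, K, hK, -, 𝒳, hX⟩ := exists_controller hP hc hproj
    exact ⟨nK, K, hK, 𝒳, hX.isSymm, hX⟩
  · rintro ⟨W, hW⟩
    obtain ⟨-, hproj, hc⟩ := (feasible_iff hΓ W).1 hW
    obtain ⟨nK, K, hK, hdeg, 𝒳, hX⟩ := exists_controller hP hc hproj
    exact ⟨nK, K, hK, hdeg, hX.solvesHinf hγ⟩
  · obtain ⟨-, hproj, hc⟩ := (feasible_iff hΓ W).1 hW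
    refine ⟨fun ν S hS => ?_, fun S hS => ?_⟩
    · exact exists_stepLMI hP hc hproj (hKb ν) (stepNeg_of_stepLMI hP hc (hproj _) hKb ν.succ
        fun μ hμ => hS μ (Fin.succ_le_castSucc_iff.1 hμ))
    · obtain ⟨𝒳, hX⟩ :=
        (stepNeg_of_stepLMI hP hc (hproj _) hKb 0 fun μ _ => hS μ).exists_boundedRealLMI hc
      exact ⟨S.controller_isStructured, S.controller_degree_le, ⟨𝒳, hX.isSymm, hX⟩,
        hX.solvesHinf hγ⟩
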